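/- Let $\nu$ be a probability measure on $\mathbb R$ with $\nu(\{0\})=0$. Let $\Omega$ be the space of configurations $\omega\subset\mathbb R_+\times\mathbb R_+\times\mathbb R$ with finitely many points in each $[0,T]\times[0,b]\times\mathbb R$, identified with the measures $N(\omega)=\sum_{p\in\omega}\delta_p$ and equipped with the $\sigma$-field generated by the maps $\omega\mapsto N(\omega)(A)$, $A$ Borel, and let $\mathbb P$ be the law under which $N$ is a Poisson random measure with intensity $dt\otimes d\theta\otimes\nu(dx)$. For a point $p$ let $\varepsilon_p^+(\omega):=\omega\cup\{p\}$ and $D_pF:=F\circ\varepsilon_p^+-F$. Let $\mu>0$, let $\Phi:\mathbb R_+\to\mathbb R_+$ be measurable with $\int_0^\infty\Phi(u)\,du<1$, and let $(X,H,\lambda)$ be the (compound) Hawkes process given by the solution of $$X_t=\int_{(0,t]\times\mathbb R_+\times\mathbb R}x\mathbf 1_{\{\theta\le\lambda_s\}}N(ds,d\theta,dx),\quad H_t=\int_{(0,t]\times\mathbb R_+\times\mathbb R}\mathbf 1_{\{\theta\le\lambda_s\}}N(ds,d\theta,dx),\quad \lambda_t=\mu+\int_{(0,t)}\Phi(t-u)\,dH_u,$$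 constructed as the limit of the Picard iterates of $\lambda$ started from $\mu$. Let $\mathbb F^X$ be the natural filtration of $X$ and $\mathcal F^X_\infty$ the $\sigma$-field generated by $X$. Let $\mathcal S$ be the set of jointly measurable processes $U=(U_{(t,\theta,x)})$ in $L^1(\mathbb P\otimes dt\otimes d\theta\otimes\nu)$ such that $D_pU_p=0$ a.s. for almost every $p=(t,\theta,x)$, $\mathbb E\int|U|^2\,dt\,d\theta\,\nu(dx)<\infty$, and $\int U\,dN$ converges absolutely a.s. and is square integrable. For $U\in\mathcal S$ let $\delta^N(U):=\int U\,dN-\int U\,dt\,d\theta\,\nu(dx)$. Let $Z=(Z_{(t,x)})_{(t,x)\in\mathbb R_+\times\mathbb R}$ be an $\mathbb F^X$-predictable process with $$\mathbb E\int_{\mathbb R_+\times\mathbb R}|Z_{(t,x)}|\lambda_t\,dt\,\nu(dx)<\infty,\qquad \mathbb E\Big[\int_{\mathbb R_+\times\mathbb R}|Z_{(t,x)}|^2\lambda_t\,dt\,\nu(dx)+\Big(\int_{\mathbb R_+\times\mathbb R}Z_{(t,x)}\lambda_t\,dt\,\nu(dx)\Big)^2\Big]<\infty.$$ Then: (i)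 the process $Z\mathbf 1_{\{\theta\le\lambda_t\}}=(Z_{(t,x)}\mathbf 1_{\{\theta\le\lambda_t\}})_{(t,\theta,x)}$ belongs to $\mathcal S$; (ii) for every $\mathcal F^X_\infty$-measurable $F$ with $\mathbb E[|F|^2]<\infty$: almost surely, for almost every $t$, for all $x$, the value $D_{(t,\theta,x)}F$ is the same for all $\theta\in[0,\lambda_t]$; it is denoted $D_{(t,\lambda_t,x)}F$. The variable $F\,\delta^N(Z\mathbf 1_{\{\theta\le\lambda_t\}})$ is integrable, and $$\mathbb E\big[F\,\delta^N(Z\mathbf 1_{\{\theta\le\lambda_t\}})\big]=\mathbb E\Big[\int_{\mathbb R_+\times\mathbb R}\lambda_tZ_{(t,x)}D_{(t,\lambda_t,x)}F\,dt\,\nu(dx)\Big]$$ whenever the right-hand side is meaningful, i.e. $\lambda_tZ_{(t,x)}D_{(t,\lambda_t,x)}F$ is integrable for $\mathbb P\otimes dt\otimes\nu$. This integrability holds for every such $F$ if moreover $\mathbb E\big[\big(\int|Z_{(t,x)}|\lambda_t\,dt\,\nu(dx)\big)^2\big]<\infty$. -/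

import Mathlib

open MeasureTheory ProbabilityTheory
open scoped NNReal ENNReal

noncomputable section

namespace HawkesIBP

/-- A point `(t, θ, x)`: jump time, auxiliary thinning variable, jump size. -/
abbrev Mark := ℝ≥0 × ℝ≥0 × ℝ

/-- Configurations: sets of points of `ℝ₊ × ℝ₊ × ℝ` with finitely many points in each
`[0, T] × [0, b] × ℝ`, identified below with integer-valued measures `∑ δ_p`. -/
@[ext]
structure Config where
  points : Set Mark
  locallyFinite : ∀ T b : ℝ≥0, (points ∩ {p | p.1 ≤ T ∧ p.2.1 ≤ b}).Finite

/-- The counting measure `N(ω) = ∑_{p ∈ ω} δ_p`. -/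
def Config.toMeasure (ω : Config) : Measure Mark :=
  Measure.sum fun p : ω.points => Measure.dirac (p : Mark)

/-- The σ-field generated by all counting variables `ω ↦ N(ω)(A)`, `A` Borel. -/
instance instMeasurableSpaceConfig : MeasurableSpace Config := MeasurableSpace.comap Config.toMeasure inferInstance

/-- The shift `ε⁺_p`, which adds the point `p` (if it is not there already). -/
def shift (p : Mark) (ω : Config) : Config where
  points := insert p ω.points
  locallyFinite T b := ((ω.locallyFinite T b).insert p).subset (by
    rintro q ⟨hq | hq, h⟩
    · exact Or.inl hq
    · exact Or.inr ⟨hq, h⟩)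

theorem Config.countable (ω : Config) : ω.points.Countable := by
  have : ω.points ⊆ ⋃ n : ℕ, (ω.points ∩ {p | p.1 ≤ (n : ℝ≥0) ∧ p.2.1 ≤ (n : ℝ≥0)}) := by
    intro p hp
    obtain ⟨n, hn⟩ := exists_nat_ge (max p.1 p.2.1)
    exact Set.mem_iUnion.2 ⟨n, hp, (le_max_left _ _).trans hn, (le_max_right _ _).trans hn⟩
  exact (Set.countable_iUnion fun n : ℕ => (ω.locallyFinite n n).countable).mono this

theorem Config.lintegral (ω : Config) (f : Mark → ℝ≥0∞) :
    ∫⁻ p, f p ∂ω.toMeasure = ∑' p : ω.points, f p := by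
  simp [Config.toMeasure, lintegral_sum_measure]

theorem Config.toMeasure_eq (ω : Config) : ω.toMeasure = Measure.count.restrict ω.points := by
  have := ω.countable
  ext A hA
  rw [Measure.restrict_apply hA, ← lintegral_indicator_one hA, ω.lintegral,
    ← lintegral_indicator_one (hA.inter this.measurableSet), lintegral_count]
  rw [tsum_subtype ω.points (A.indicator 1)]
  congr 1; ext p
  by_cases h1 : p ∈ ω.points <;> by_cases h2 : p ∈ A <;> simp [h1, h2]

/-- The defining formula `ε⁺_p(ω)(A) = ω(A \ {p}) + 1_A(p)` of the shift. -/
theorem shift_apply (p : Mark) (ω : Config) {A : Set Mark} (hA : MeasurableSet A) :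
    (shift p ω).toMeasure A = ω.toMeasure (A \ {p}) + A.indicator 1 p := by
  classical
  rw [Config.toMeasure_eq, Config.toMeasure_eq, Measure.restrict_apply hA,
    Measure.restrict_apply (hA.diff (measurableSet_singleton p))]
  by_cases hp : p ∈ A
  · have : A ∩ (shift p ω).points = (A \ {p} ∩ ω.points) ∪ {p} := by
      ext q; by_cases h : q = p <;> simp [shift, h, hp]
    rw [this, measure_union (by simp) (measurableSet_singleton p)]
    simp [hp]
  · have : A ∩ (shift p ω).points = (A \ {p} ∩ ω.points) := by
      ext q; by_cases h : q = p <;> simp [shift, h, hp]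
    simp [this, hp]

/-- `ω ↦ N(ω)` as a kernel. -/
def countingKernel : Kernel Config Mark := ⟨Config.toMeasure, comap_measurable _⟩

theorem isSFiniteKernel_of_finite {α β : Type*} {mα : MeasurableSpace α} {mβ : MeasurableSpace β}
    (κ : Kernel α β) (h : ∀ a, κ a Set.univ < ∞) : IsSFiniteKernel κ := by
  classical
  have hm : ∀ n : ℕ, MeasurableSet {a | (n : ℝ≥0∞) ≤ κ a Set.univ ∧ κ a Set.univ < n + 1} :=
    fun n => (measurableSet_le measurable_const (κ.measurable_coe MeasurableSet.univ)).inter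
      (measurableSet_lt (κ.measurable_coe MeasurableSet.univ) measurable_const)
  refine ⟨⟨fun n => Kernel.piecewise (hm n) κ 0, fun n => ⟨⟨n + 1, by finiteness, fun a => ?_⟩⟩, ?_⟩⟩
  · rw [Kernel.piecewise_apply]
    split_ifs with ha
    · exact ha.2.le
    · simp
  · ext a s hs
    rw [Kernel.sum_apply' _ _ hs]
    set r : ℝ≥0 := (κ a Set.univ).toNNReal with hr
    have hr' : κ a Set.univ = r := (ENNReal.coe_toNNReal (h a).ne).symm
    rw [tsum_eq_single ⌊r⌋₊]
    · rw [Kernel.piecewise_apply, if_pos]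
      simp only [Set.mem_ofPred_eq, hr']
      exact ⟨by exact_mod_cast Nat.floor_le (zero_le : 0 ≤ r), by exact_mod_cast Nat.lt_floor_add_one r⟩
    · intro n hn
      rw [Kernel.piecewise_apply, if_neg]
      · simp
      · rintro ⟨h1, h2⟩
        rw [hr'] at h1 h2
        exact hn ((Nat.floor_eq_iff (zero_le : 0 ≤ r)).2 ⟨by exact_mod_cast h1, by exact_mod_cast h2⟩).symm

instance : IsSFiniteKernel countingKernel := by
  have hm : ∀ i : ℕ × ℕ, MeasurableSet {p : Mark | ⌊p.1⌋₊ = i.1 ∧ ⌊p.2.1⌋₊ = i.2} := fun i =>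
    ((Nat.measurable_floor.comp measurable_fst) (measurableSet_singleton i.1)).inter
      ((Nat.measurable_floor.comp (measurable_fst.comp measurable_snd))
        (measurableSet_singleton i.2))
  have : countingKernel = Kernel.sum fun i => countingKernel.restrict (hm i) := by
    ext1 ω
    rw [Kernel.sum_apply]
    simp only [Kernel.restrict_apply]
    rw [← Measure.restrict_iUnion _ hm]
    · have hu : ⋃ i : ℕ × ℕ, {p : Mark | ⌊p.1⌋₊ = i.1 ∧ ⌊p.2.1⌋₊ = i.2} = Set.univ :=
        Set.iUnion_eq_univ_iff.2 fun p => ⟨(⌊p.1⌋₊, ⌊p.2.1⌋₊), rfl, rfl⟩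
      rw [hu, Measure.restrict_univ]
    · intro i j hij
      refine Set.disjoint_left.2 fun p hp hq => hij (Prod.ext ?_ ?_)
      · exact hp.1.symm.trans hq.1
      · exact hp.2.symm.trans hq.2
  rw [this]
  have (i : ℕ × ℕ) : IsSFiniteKernel (countingKernel.restrict (hm i)) := by
    refine isSFiniteKernel_of_finite _ fun ω => ?_
    rw [Kernel.restrict_apply, Measure.restrict_apply_univ]
    change ω.toMeasure _ < ∞
    rw [Config.toMeasure_eq, Measure.restrict_apply (hm i), Set.inter_comm]
    refine Measure.count_apply_lt_top.2 ((ω.locallyFinite (i.1 + 1) (i.2 + 1)).subset ?_)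
    rintro p ⟨hp, h1, h2⟩
    refine ⟨hp, ?_, ?_⟩
    · rw [← h1]; exact (Nat.lt_floor_add_one _).le
    · rw [← h2]; exact (Nat.lt_floor_add_one _).le
  infer_instance

/-- Lebesgue measure on `ℝ₊`. -/
def lebesgue : Measure ℝ≥0 := Measure.comap NNReal.toReal volume

instance : SigmaFinite lebesgue := by
  refine ⟨⟨⟨fun n => Set.Iic (n : ℝ≥0), fun _ => trivial, fun n => ?_, ?_⟩⟩⟩
  · have he : MeasurableEmbedding NNReal.toReal := MeasurableEmbedding.subtype_coe measurableSet_Ici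
    rw [lebesgue, he.comap_apply]
    refine (measure_mono (t := Set.Icc (0 : ℝ) n) ?_).trans_lt (by simp)
    rintro _ ⟨x, hx, rfl⟩
    exact ⟨x.2, by exact_mod_cast (show x ≤ (n : ℝ≥0) from hx)⟩
  · exact Set.iUnion_eq_univ_iff.2 fun x => exists_nat_ge x

/-- The intensity measure `dt ⊗ dθ ⊗ ν`. -/
def intensityMeasure (ν : Measure ℝ) : Measure Mark := lebesgue.prod (lebesgue.prod ν)

/-- `P` is the law of a Poisson random measure with intensity measure `m`. -/
structure IsPoissonLaw (P : Measure Config) (m : Measure Mark) : Prop where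
  law : ∀ A : Set Mark, MeasurableSet A → m A ≠ ∞ →
    P.map (fun ω => ω.toMeasure A) =
      (poissonMeasure (m A).toNNReal).map (fun k : ℕ => (k : ℝ≥0∞))
  indep : ∀ (n : ℕ) (A : Fin n → Set Mark), (∀ i, MeasurableSet (A i)) →
    Pairwise (fun i j => Disjoint (A i) (A j)) →
    iIndepFun (fun i ω => ω.toMeasure (A i)) P

/-! ### The Hawkes process -/

/-- Picard iterates `λ⁰ = μ`, `λⁿ⁺¹_t = μ + ∫_{(0,t)} Φ(t-s) 1_{θ ≤ λⁿ_s} N(ds, dθ, dx)`. -/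
def picard (μ : ℝ≥0) (Φ : ℝ≥0 → ℝ≥0) : ℕ → Config → ℝ≥0 → ℝ≥0∞
  | 0, _, _ => μ
  | n + 1, ω, t => μ + ∫⁻ p, (if 0 < p.1 ∧ p.1 < t ∧ (p.2.1 : ℝ≥0∞) ≤ picard μ Φ n ω p.1
      then (Φ (t - p.1) : ℝ≥0∞) else 0) ∂ω.toMeasure

/-- The Hawkes intensity `λ_t`, the (increasing) limit of the Picard iterates. It solves the
Hawkes equation up to the explosion time of `H`, see `hawkesIntensity_eq`. -/
def hawkesIntensity (μ : ℝ≥0) (Φ : ℝ≥0 → ℝ≥0) (ω : Config) (t : ℝ≥0) : ℝ≥0∞ :=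
  ⨆ n, picard μ Φ n ω t

/-- The Hawkes process `H_t = ∫_{(0,t]} 1_{θ ≤ λ_s} N(ds, dθ, dx)`. -/
def hawkesCount (μ : ℝ≥0) (Φ : ℝ≥0 → ℝ≥0) (t : ℝ≥0) (ω : Config) : ℝ≥0∞ :=
  ∫⁻ p, (if 0 < p.1 ∧ p.1 ≤ t ∧ (p.2.1 : ℝ≥0∞) ≤ hawkesIntensity μ Φ ω p.1 then 1 else 0)
    ∂ω.toMeasure

/-- The compound Hawkes process `X_t = ∫_{(0,t]} x 1_{θ ≤ λ_s} N(ds, dθ, dx)`. -/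
def compoundHawkes (μ : ℝ≥0) (Φ : ℝ≥0 → ℝ≥0) (t : ℝ≥0) (ω : Config) : ℝ :=
  ∫ p, (if 0 < p.1 ∧ p.1 ≤ t ∧ (p.2.1 : ℝ≥0∞) ≤ hawkesIntensity μ Φ ω p.1 then p.2.2 else 0)
    ∂ω.toMeasure

theorem picard_mono (μ : ℝ≥0) (Φ : ℝ≥0 → ℝ≥0) (ω : Config) (t : ℝ≥0) :
    Monotone fun n => picard μ Φ n ω t := by
  refine monotone_nat_of_le_succ fun n => ?_
  induction n generalizing t with
  | zero => simp [picard]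
  | succ n ih =>
    rw [picard, picard]
    refine add_le_add le_rfl (lintegral_mono fun p => ?_)
    dsimp only
    split_ifs with h1 h2 h2
    · exact le_rfl
    · exact absurd ⟨h1.1, h1.2.1, h1.2.2.trans (ih _)⟩ h2
    · exact zero_le
    · exact le_rfl

/-- As long as `H` does not explode, `λ_t = μ + ∫_{(0,t)} Φ(t-s) dH_s`. -/
theorem hawkesIntensity_eq (μ : ℝ≥0) (Φ : ℝ≥0 → ℝ≥0) (ω : Config) (t : ℝ≥0)
    (h : hawkesCount μ Φ t ω < ∞) :
    hawkesIntensity μ Φ ω t = μ + ∫⁻ p,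
      (if 0 < p.1 ∧ p.1 < t ∧ (p.2.1 : ℝ≥0∞) ≤ hawkesIntensity μ Φ ω p.1
        then (Φ (t - p.1) : ℝ≥0∞) else 0) ∂ω.toMeasure := by
  set S : Set Mark := {p | p ∈ ω.points ∧ 0 < p.1 ∧ p.1 ≤ t ∧
    (p.2.1 : ℝ≥0∞) ≤ hawkesIntensity μ Φ ω p.1} with hS
  have hfin : S.Finite := by
    rw [hawkesCount, ω.lintegral] at h
    refine ((ENNReal.finite_const_le_of_tsum_ne_top h.ne one_ne_zero).image Subtype.val).subset ?_
    rintro p ⟨hp, h1⟩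
    refine ⟨⟨p, hp⟩, ?_, rfl⟩
    change (1 : ℝ≥0∞) ≤ if _ then _ else _
    rw [if_pos h1]
  have hev : ∀ᶠ n in Filter.atTop, ∀ p ∈ S, ((p.2.1 : ℝ≥0∞) ≤ picard μ Φ n ω p.1 ↔
      ∃ m, (p.2.1 : ℝ≥0∞) ≤ picard μ Φ m ω p.1) := by
    refine (Filter.eventually_all_finite hfin).2 fun p _ => ?_
    by_cases hp : ∃ m, (p.2.1 : ℝ≥0∞) ≤ picard μ Φ m ω p.1
    · obtain ⟨m, hm⟩ := hp
      filter_upwards [Filter.eventually_ge_atTop m] with n hn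
      exact ⟨fun h => ⟨n, h⟩, fun _ => hm.trans (picard_mono μ Φ ω p.1 hn)⟩
    · exact Filter.Eventually.of_forall fun n => ⟨fun h => ⟨n, h⟩, fun h => absurd h hp⟩
  obtain ⟨N, hN⟩ := Filter.eventually_atTop.1 hev
  have key : ∀ s ≤ t, ∀ n ≥ N, picard μ Φ (n + 1) ω s = picard μ Φ (N + 1) ω s := by
    intro s hs n hn
    rw [picard, picard, ω.lintegral, ω.lintegral]
    congr 1
    refine tsum_congr fun p => ?_
    refine if_congr (and_congr_right fun h0 => and_congr_right fun h1 => ?_) rfl rfl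
    by_cases hp : (p : Mark) ∈ S
    · rw [hN n hn p hp, hN N le_rfl p hp]
    · have hlt : ∀ k, ¬ ((p : Mark).2.1 : ℝ≥0∞) ≤ picard μ Φ k ω (p : Mark).1 := fun k hk =>
        hp ⟨p.2, h0, (h1.trans_le hs).le, hk.trans (le_iSup (fun n => picard μ Φ n ω _) k)⟩
      simp [hlt]
  have hlam : ∀ s ≤ t, hawkesIntensity μ Φ ω s = picard μ Φ (N + 1) ω s := by
    intro s hs
    refine le_antisymm (iSup_le fun n => ?_) (le_iSup (fun n => picard μ Φ n ω s) (N + 1))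
    rw [← key s hs (max n N) (le_max_right _ _)]
    exact picard_mono μ Φ ω s ((le_max_left n N).trans (Nat.le_succ _))
  rw [hlam t le_rfl, ← key t le_rfl (N + 1) (Nat.le_succ N), picard]
  congr 1
  refine lintegral_congr fun p => ?_
  refine if_congr (and_congr_right fun _ => and_congr_right fun h1 => ?_) rfl rfl
  rw [hlam p.1 h1.le]

theorem measurable_picard (μ : ℝ≥0) {Φ : ℝ≥0 → ℝ≥0} (hΦ : Measurable Φ) (n : ℕ) :
    Measurable fun q : Config × ℝ≥0 => picard μ Φ n q.1 q.2 := by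
  induction n with
  | zero => exact measurable_const
  | succ n ih =>
    simp only [picard]
    refine Measurable.add (f := fun _ => (μ : ℝ≥0∞)) measurable_const ?_
    have hk : Measurable (Prod.fst : Config × ℝ≥0 → Config) := measurable_fst
    have := Measurable.lintegral_kernel_prod_right (κ := countingKernel.comap _ hk)
      (f := fun (q : Config × ℝ≥0) (p : Mark) => if 0 < p.1 ∧ p.1 < q.2 ∧ (p.2.1 : ℝ≥0∞) ≤ picard μ Φ n q.1 p.1
        then (Φ (q.2 - p.1) : ℝ≥0∞) else 0) ?_
    · exact this
    · refine Measurable.ite ?_ (by fun_prop) measurable_const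
      refine (measurableSet_lt (by fun_prop) (by fun_prop)).inter
        ((measurableSet_lt (by fun_prop) (by fun_prop)).inter
          (measurableSet_le (f := fun x : (Config × ℝ≥0) × Mark => (x.2.2.1 : ℝ≥0∞))
            (by fun_prop) ?_))
      exact ih.comp (f := fun x : (Config × ℝ≥0) × Mark => (x.1.1, x.2.1)) (by fun_prop)

theorem measurable_hawkesIntensity (μ : ℝ≥0) {Φ : ℝ≥0 → ℝ≥0} (hΦ : Measurable Φ) :
    Measurable fun q : Config × ℝ≥0 => hawkesIntensity μ Φ q.1 q.2 :=
  Measurable.iSup fun n => measurable_picard μ hΦ n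

theorem stronglyMeasurable_compoundHawkes (μ : ℝ≥0) {Φ : ℝ≥0 → ℝ≥0} (hΦ : Measurable Φ)
    (t : ℝ≥0) : StronglyMeasurable (compoundHawkes μ Φ t) := by
  refine StronglyMeasurable.integral_kernel_prod_right' (κ := countingKernel)
    (f := fun q : Config × Mark => if 0 < q.2.1 ∧ q.2.1 ≤ t ∧
      (q.2.2.1 : ℝ≥0∞) ≤ hawkesIntensity μ Φ q.1 q.2.1 then q.2.2.2 else 0)
    (Measurable.stronglyMeasurable ?_)
  refine Measurable.ite ?_ (measurable_snd.comp (measurable_snd.comp measurable_snd))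
    measurable_const
  refine (measurableSet_lt measurable_const (by fun_prop)).inter
    ((measurableSet_le (by fun_prop) measurable_const).inter
      (measurableSet_le
        (f := fun x : Config × Mark => (x.2.2.1 : ℝ≥0∞)) (by fun_prop) ?_))
  exact (measurable_hawkesIntensity μ hΦ).comp
    (f := fun x : Config × Mark => (x.1, x.2.1)) (by fun_prop)

/-- The natural filtration `𝔽^X` of the compound Hawkes process. -/
def filtrationX (μ : ℝ≥0) {Φ : ℝ≥0 → ℝ≥0} (hΦ : Measurable Φ) :
    Filtration ℝ≥0 instMeasurableSpaceConfig :=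
  Filtration.natural (compoundHawkes μ Φ) (stronglyMeasurable_compoundHawkes μ hΦ)

/-- `ℱ^X_∞`. -/
@[reducible]
def sigmaX (μ : ℝ≥0) {Φ : ℝ≥0 → ℝ≥0} (hΦ : Measurable Φ) : MeasurableSpace Config :=
  ⨆ t, filtrationX μ hΦ t

/-- `Z = (Z_{(t,x)})` is `𝔽`-predictable: measurable for `𝒫(𝔽) ⊗ ℬ(ℝ)`, with `𝒫(𝔽)` the
predictable σ-field on `ℝ₊ × Ω`. -/
def IsMarkedPredictable (𝓕 : Filtration ℝ≥0 instMeasurableSpaceConfig)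
    (Z : ℝ≥0 → ℝ → Config → ℝ) : Prop :=
  Measurable[𝓕.predictable.prod Real.measurableSpace]
    fun q : (ℝ≥0 × Config) × ℝ => Z q.1.1 q.2 q.1.2

/-! ### Malliavin derivative and divergence -/

/-- The Malliavin derivative `D_p F = F ∘ ε⁺_p - F`. -/
def malliavin (F : Config → ℝ) (p : Mark) (ω : Config) : ℝ := F (shift p ω) - F ω

/-- `D_{(t,λ_t,x)} F`: the Malliavin derivative at `θ = λ_t(ω)`. -/
def malliavinHawkes (μ : ℝ≥0) (Φ : ℝ≥0 → ℝ≥0) (F : Config → ℝ) (t : ℝ≥0) (x : ℝ)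
    (ω : Config) : ℝ :=
  malliavin F (t, (hawkesIntensity μ Φ ω t).toNNReal, x) ω

/-- The class `ℐ`: jointly measurable `Z ∈ L¹(P ⊗ dt ⊗ dθ ⊗ ν)` with `D_p Z_p = 0` for almost
all `p`. -/
structure MemI (P : Measure Config) (ν : Measure ℝ) (Z : Mark → Config → ℝ) : Prop where
  measurable : Measurable fun q : Config × Mark => Z q.2 q.1
  integrable : Integrable (fun q : Config × Mark => Z q.2 q.1) (P.prod (intensityMeasure ν))
  malliavin_eq_zero : ∀ᵐ p ∂intensityMeasure ν, ∀ᵐ ω ∂P, malliavin (Z p) p ω = 0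

/-- The class `𝒮`, the domain of the divergence; the Stieltjes integral of `Z` against `N` is
required to converge absolutely almost surely. -/
structure MemS (P : Measure Config) (ν : Measure ℝ) (Z : Mark → Config → ℝ) : Prop
    extends MemI P ν Z where
  sq_lt_top : ∫⁻ ω, ∫⁻ p, ‖Z p ω‖ₑ ^ 2 ∂intensityMeasure ν ∂P < ∞
  integrable_counting : ∀ᵐ ω ∂P, Integrable (fun p => Z p ω) ω.toMeasure
  memLp_counting : MemLp (fun ω => ∫ p, Z p ω ∂ω.toMeasure) 2 P

/-- The divergence `δ^N(Z) = ∫ Z dN - ∫ Z dt dθ ν(dx)`. -/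
def divergence (ν : Measure ℝ) (Z : Mark → Config → ℝ) (ω : Config) : ℝ :=
  ∫ p, Z p ω ∂ω.toMeasure - ∫ p, Z p ω ∂intensityMeasure ν

/-- The process `Z_{(t,x)} 1_{θ ≤ λ_t}`. -/
def thinned (μ : ℝ≥0) (Φ : ℝ≥0 → ℝ≥0) (Z : ℝ≥0 → ℝ → Config → ℝ) (p : Mark) (ω : Config) : ℝ :=
  if (p.2.1 : ℝ≥0∞) ≤ hawkesIntensity μ Φ ω p.1 then Z p.1 p.2.2 ω else 0

end HawkesIBP

end

namespace HawkesIBP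

/-! Everything rests on the Mecke formula: for $m=dt\otimes d\theta\otimes\nu$ and $h\ge 0$,
$\mathbb E\int h(\omega,p)\,N(dp)=\mathbb E\int h(\varepsilon_p^+\omega,p)\,m(dp)$. A process $u$ is
nonanticipating if $u_p$ ignores points at or after the time of $p$; then
$u_p\circ\varepsilon_p^+=u_p$, and the formula applied to $Fu$ gives $\mathbb
E[F\,\delta^N(u)]=\mathbb E\int u_pD_pF\,m(dp)$, provided that $Fu$ is integrable both for $N$ and
for $m$ (`BoxBounded.integral_mul_divergence`).

Here only the product $u\,DF$ is assumed integrable, so the formula is first proved for bounded $u$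
with support in a box and then extended by truncation. The extension needs an $L^2$ bound for
$\delta^N$. For bounded $u$, taking $F=\delta^N(u)$ and using $D_p\delta^N(u)=u_p+\delta^N(D_pu)$
gives the isometry $\mathbb E|\delta^N(u)|^2=\mathbb E\int u^2\,dm$, because $u_p\,\delta^N(D_pu)$
is the divergence of a nonanticipating process and has mean zero. Fatou's lemma turns this into an
inequality for all $u$ in $L^1\cap L^2$. Cauchy–Schwarz then controls the left side of the formula
and dominated convergence the right side (`NonAnticipating.integral_mul_divergence`).

Two facts link this to the Hawkes process. First, adding a point at time $s$ changes neither
$\lambda_t$ nor any predictable $Z_{(t,x)}$ for $t\le s$, so $Z\mathbf 1_{\{\theta\le\lambda_t\}}$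
is nonanticipating. Second, an accepted point acts on $X$ only through its time and its jump size,
so $D_{(t,\theta,x)}F$ is constant in $\theta\in[0,\lambda_t]$, and integrating over $\theta$
produces the factor $\lambda_t$. For the endpoint $\theta=\lambda_t$ to be accepted, some Picard
iterate must attain the limit. This holds when there is no explosion, which follows from $\mathbb
E\lambda_t\le\mu/(1-\int\Phi)$. -/

theorem lebesgue_Iic (t : ℝ≥0) : lebesgue (Set.Iic t) = t := by
  have he : MeasurableEmbedding NNReal.toReal := MeasurableEmbedding.subtype_coe measurableSet_Ici
  rw [lebesgue, he.comap_apply]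
  have : NNReal.toReal '' Set.Iic t = Set.Icc (0 : ℝ) t := by
    ext x
    constructor
    · rintro ⟨y, hy, rfl⟩
      exact ⟨y.2, by exact_mod_cast (show y ≤ t from hy)⟩
    · rintro ⟨h0, h1⟩
      exact ⟨⟨x, h0⟩, (show (⟨x, h0⟩ : ℝ≥0) ≤ t from by exact_mod_cast h1), rfl⟩
  rw [this]
  simp

instance : NullSingletonClass lebesgue := ⟨fun t => by
  have he : MeasurableEmbedding NNReal.toReal := MeasurableEmbedding.subtype_coe measurableSet_Ici
  rw [lebesgue, he.comap_apply]
  simp⟩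

instance (ν : Measure ℝ) [IsProbabilityMeasure ν] : SigmaFinite (intensityMeasure ν) := by
  unfold intensityMeasure; infer_instance

instance (ν : Measure ℝ) [IsProbabilityMeasure ν] : NullSingletonClass (intensityMeasure ν) := by
  unfold intensityMeasure; infer_instance

/-! ### Measurability of the counts and of the shift -/

theorem measurable_toMeasure : Measurable Config.toMeasure := comap_measurable _

theorem measurable_toMeasure_apply {A : Set Mark} (hA : MeasurableSet A) :
    Measurable fun ω : Config => ω.toMeasure A :=
  (Measure.measurable_coe hA).comp measurable_toMeasure

theorem measurable_shift : Measurable fun q : Config × Mark => shift q.2 q.1 := by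
  classical
  refine measurable_comap_iff.2 (Measure.measurable_of_measurable_coe _ fun A hA => ?_)
  -- The set `A \ {q.2}` moves with the parameter, so its mass is written as the integral of a
  -- jointly measurable function against the counting kernel.
  have h1 : ∀ q : Config × Mark, ((Config.toMeasure ∘ fun q : Config × Mark => shift q.2 q.1) q) A =
      (∫⁻ p, (if p ∈ A ∧ p ≠ q.2 then 1 else 0) ∂q.1.toMeasure) + A.indicator 1 q.2 := by
    intro q
    rw [Function.comp_apply, shift_apply _ _ hA,
      ← lintegral_indicator_one (hA.diff (measurableSet_singleton _))]
    simp [Set.indicator_apply]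
  simp only [h1]
  refine Measurable.add ?_ ((measurable_one.indicator hA).comp measurable_snd)
  refine Measurable.lintegral_kernel_prod_right
    (κ := countingKernel.comap _ (measurable_fst : Measurable (Prod.fst : Config × Mark → Config)))
    (f := fun (q : Config × Mark) (p : Mark) => if p ∈ A ∧ p ≠ q.2 then 1 else 0) ?_
  refine Measurable.ite ?_ measurable_const measurable_const
  exact (measurable_snd hA).inter
    (measurableSet_eq_fun measurable_snd (measurable_snd.comp measurable_fst)).compl

/-! ### The Mecke formula -/

theorem lintegral_mul_map_poissonMeasure (r : ℝ≥0) {g : ℝ≥0∞ → ℝ≥0∞} (hg : Measurable g) :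
    ∫⁻ c, c * g c ∂(poissonMeasure r).map (fun k : ℕ => (k : ℝ≥0∞)) =
      r * ∫⁻ c, g (c + 1) ∂(poissonMeasure r).map (fun k : ℕ => (k : ℝ≥0∞)) := by
  rw [lintegral_map (by fun_prop) (by fun_prop), lintegral_map (by fun_prop) (by fun_prop)]
  simp only [poissonMeasure, lintegral_sum_measure, lintegral_smul_measure, lintegral_dirac,
    smul_eq_mul]
  -- The term $k=0$ is killed by the factor $c$; for the others, $(n+1)\,r^{n+1}/(n+1)!=r\cdot
  -- r^n/n!$.
  rw [tsum_eq_zero_add' ENNReal.summable, ← ENNReal.tsum_mul_left]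
  simp only [Nat.cast_zero, zero_mul, mul_zero, zero_add]
  refine tsum_congr fun n => ?_
  have : ENNReal.ofReal (Real.exp (-r) * r ^ (n + 1) / (n + 1).factorial) * ((n + 1 : ℕ) : ℝ≥0∞) =
      r * ENNReal.ofReal (Real.exp (-r) * r ^ n / n.factorial) := by
    rw [← ENNReal.ofReal_natCast, ← ENNReal.ofReal_coe_nnreal,
      ← ENNReal.ofReal_mul (by positivity), ← ENNReal.ofReal_mul (by positivity)]
    congr 1
    rw [Nat.factorial_succ]
    push_cast
    field_simp
    ring
  rw [← mul_assoc, this, mul_assoc]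
  push_cast
  rfl

/-- Tonelli: coordinate `j` is integrated first, with the others frozen, and the one-dimensional
identity applies. -/
theorem lintegral_mul_pi_of_size_bias {ι : Type*} [Fintype ι] [DecidableEq ι]
    (m : ι → Measure ℝ≥0∞) [∀ i, SigmaFinite (m i)] (j : ι) (r : ℝ≥0∞)
    (h : ∀ g : ℝ≥0∞ → ℝ≥0∞, Measurable g → ∫⁻ c, c * g c ∂m j = r * ∫⁻ c, g (c + 1) ∂m j)
    {f : (ι → ℝ≥0∞) → ℝ≥0∞} (hf : Measurable f) :
    ∫⁻ c, c j * f c ∂Measure.pi m = r * ∫⁻ c, f (Function.update c j (c j + 1)) ∂Measure.pi m := by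
  have hu : Measurable fun c : ι → ℝ≥0∞ => f (Function.update c j (c j + 1)) := by
    refine hf.comp (measurable_pi_iff.2 fun i => ?_)
    by_cases hi : i = j
    · subst hi
      simp only [Function.update_self]
      fun_prop
    · simp only [Function.update_of_ne hi]
      fun_prop
  rw [← lintegral_const_mul _ hu,
    lintegral_eq_lmarginal_univ 0, lintegral_eq_lmarginal_univ 0,
    lmarginal_erase' (hf := by fun_prop) (hi := Finset.mem_univ j),
    lmarginal_erase' (hf := hu.const_mul r) (hi := Finset.mem_univ j)]
  congr 1
  ext x
  simp only [Function.update_self, Function.update_idem]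
  rw [h _ (by fun_prop), lintegral_const_mul]
  fun_prop

section Poisson

variable {P : Measure Config} {m : Measure Mark}

/-- Since `m` has no atoms, the count of `{p}` is Poisson with parameter zero. -/
theorem IsPoissonLaw.ae_notMem [NullSingletonClass m] (hP : IsPoissonLaw P m) (p : Mark) :
    ∀ᵐ ω ∂P, p ∉ ω.points := by
  have h := hP.law {p} (measurableSet_singleton p) (by simp)
  have h0 : P ((fun ω : Config => ω.toMeasure {p}) ⁻¹' {0}ᶜ) = 0 := by
    rw [← Measure.map_apply (measurable_toMeasure_apply (measurableSet_singleton p))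
      (measurableSet_singleton 0).compl, h, Measure.map_apply (by fun_prop)
      (measurableSet_singleton 0).compl]
    simp only [measure_singleton, ENNReal.toNNReal_zero]
    rw [poissonMeasure, Measure.sum_apply _ (MeasurableSet.of_discrete)]
    simp only [Measure.smul_apply, smul_eq_mul, ENNReal.tsum_eq_zero]
    intro n
    rcases Nat.eq_zero_or_pos n with rfl | hn
    · simp
    · simp [hn.ne']
  refine measure_mono_null (fun ω hω => ?_) h0
  simp only [Set.mem_compl_iff, Set.mem_ofPred_eq, not_not] at hω
  simp only [Set.mem_preimage, Set.mem_compl_iff, Set.mem_singleton_iff]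
  rw [Config.toMeasure_eq, Measure.restrict_apply (measurableSet_singleton p)]
  rw [Set.inter_eq_left.2 (by simpa using hω)]
  simp

theorem toMeasure_shift_of_notMem {p : Mark} {ω : Config} (hp : p ∉ ω.points) :
    (shift p ω).toMeasure = ω.toMeasure + Measure.dirac p := by
  ext A hA
  rw [shift_apply _ _ hA, Measure.add_apply, Measure.dirac_apply' _ hA]
  congr 1
  rw [Config.toMeasure_eq, Measure.restrict_apply hA,
    Measure.restrict_apply (hA.diff (measurableSet_singleton p))]
  congr 1
  ext q
  constructor
  · rintro ⟨⟨h1, _⟩, h2⟩; exact ⟨h1, h2⟩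
  · rintro ⟨h1, h2⟩; exact ⟨⟨h1, fun h => hp (h ▸ h2)⟩, h2⟩

/-- Mecke formula on disjoint sets. The counts are independent, and adding a point of `C j` raises
only the `j`-th count by one, so the integrand on the right is constant over `C j`. What remains is
size-biasing of a Poisson variable. Only `C j` needs finite intensity. -/
theorem IsPoissonLaw.lintegral_cylinder [IsProbabilityMeasure P] [NullSingletonClass m] (hP : IsPoissonLaw P m) {ι : Type*} [Fintype ι]
    (C : ι → Set Mark) (hC : ∀ i, MeasurableSet (C i)) (hd : Pairwise fun i j => Disjoint (C i) (C j))
    (j : ι) (hj : m (C j) ≠ ∞) {f : (ι → ℝ≥0∞) → ℝ≥0∞} (hf : Measurable f) :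
    ∫⁻ ω, ω.toMeasure (C j) * f (fun i => ω.toMeasure (C i)) ∂P =
      ∫⁻ p in C j, ∫⁻ ω, f (fun i => (shift p ω).toMeasure (C i)) ∂P ∂m := by
  classical
  have hN : Measurable fun (ω : Config) (i : ι) => ω.toMeasure (C i) :=
    measurable_pi_iff.2 fun i => measurable_toMeasure_apply (hC i)
  have hind : iIndepFun (fun i (ω : Config) => ω.toMeasure (C i)) P := by
    have e := Fintype.equivFin ι
    have := hP.indep _ (fun k => C (e.symm k)) (fun _ => hC _)
      (fun a b hab => hd (e.symm.injective.ne hab))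
    simpa using this.precomp e.injective
  have hlaw := (iIndepFun_iff_map_fun_eq_pi_map
    (fun i => (measurable_toMeasure_apply (hC i)).aemeasurable)).1 hind
  have : ∀ i, IsProbabilityMeasure (P.map fun ω : Config => ω.toMeasure (C i)) := fun i =>
    Measure.isProbabilityMeasure_map (measurable_toMeasure_apply (hC i)).aemeasurable
  have hu : Measurable fun c : ι → ℝ≥0∞ => f (Function.update c j (c j + 1)) := by
    refine hf.comp (measurable_pi_iff.2 fun i => ?_)
    by_cases hi : i = j
    · subst hi
      simp only [Function.update_self]
      fun_prop
    · simp only [Function.update_of_ne hi]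
      fun_prop
  have key := lintegral_mul_pi_of_size_bias (fun i => P.map fun ω : Config => ω.toMeasure (C i)) j
    (m (C j)) (fun g hg => by
      rw [hP.law (C j) (hC j) hj, lintegral_mul_map_poissonMeasure _ hg, ENNReal.coe_toNNReal hj]) hf
  rw [← hlaw, lintegral_map (by fun_prop) hN, lintegral_map hu hN] at key
  rw [key]
  have h1 : ∀ p ∈ C j, ∫⁻ ω, f (fun i => (shift p ω).toMeasure (C i)) ∂P =
      ∫⁻ ω, f (Function.update (fun i => ω.toMeasure (C i)) j (ω.toMeasure (C j) + 1)) ∂P := by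
    intro p hp
    refine lintegral_congr_ae ?_
    filter_upwards [hP.ae_notMem p] with ω hω
    congr 1
    ext i
    rw [toMeasure_shift_of_notMem hω, Measure.add_apply, Measure.dirac_apply' _ (hC i)]
    by_cases hi : i = j
    · subst hi
      simp [hp]
    · have : p ∉ C i := fun h => Set.disjoint_left.1 (hd hi) h hp
      simp [hi, this]
  rw [setLIntegral_congr_fun (hC j) h1, setLIntegral_const, mul_comm]

/-- The sets of `t` and `B` may overlap; they are cut into the atoms of the finite algebra they
generate. The event depends on the counts of the atoms only, and the disjoint case is summed over
the atoms that make up `B`. -/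
theorem IsPoissonLaw.setLIntegral_cylinder [IsProbabilityMeasure P] [NullSingletonClass m] (hP : IsPoissonLaw P m)
    {B : Set Mark} (hB : MeasurableSet B) (hmB : m B ≠ ∞) (t : Finset (Set Mark))
    (ht : ∀ A ∈ t, MeasurableSet A) (S : Set Mark → Set ℝ≥0∞) (hS : ∀ A ∈ t, MeasurableSet (S A)) :
    ∫⁻ ω in ⋂ A ∈ t, (fun ω : Config => ω.toMeasure A) ⁻¹' S A, ω.toMeasure B ∂P =
      ∫⁻ p in B, P (shift p ⁻¹' ⋂ A ∈ t, (fun ω : Config => ω.toMeasure A) ⁻¹' S A) ∂m := by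
  classical
  set T := insert B t with hT
  have hTm : ∀ A ∈ T, MeasurableSet A := by
    intro A hA
    rcases Finset.mem_insert.1 hA with rfl | hA
    · exact hB
    · exact ht A hA
  -- The function `φ` records which sets of `T` contain `p`; its fibres `C σ` are the atoms.
  let φ : Mark → (T → Prop) := fun p A => p ∈ (A : Set Mark)
  have hφ : Measurable φ := measurable_pi_iff.2 fun A => by
    exact measurable_mem.2 (hTm A A.2)
  let C : (T → Prop) → Set Mark := fun σ => φ ⁻¹' {σ}
  have hC : ∀ σ, MeasurableSet (C σ) := fun σ => hφ (measurableSet_singleton σ)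
  have hd : Pairwise fun σ τ => Disjoint (C σ) (C τ) := fun σ τ h =>
    Disjoint.preimage _ (Set.disjoint_singleton.2 h)
  have hsum : ∀ (A : T) (ρ : Measure Mark),
      ρ A = ∑ σ ∈ Finset.univ.filter (fun σ : T → Prop => σ A), ρ (C σ) := by
    intro A ρ
    rw [sum_measure_preimage_singleton _ fun σ _ => hC σ]
    congr 1
    ext p
    simp [φ]
  let f : ((T → Prop) → ℝ≥0∞) → ℝ≥0∞ := fun c =>
    Set.indicator {c | ∀ A : T, (A : Set Mark) ∈ t →
      ∑ σ ∈ Finset.univ.filter (fun σ : T → Prop => σ A), c σ ∈ S A} 1 c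
  have hset : MeasurableSet {c : (T → Prop) → ℝ≥0∞ | ∀ A : T, (A : Set Mark) ∈ t →
      ∑ σ ∈ Finset.univ.filter (fun σ : T → Prop => σ A), c σ ∈ S A} := by
    simp only [Set.ofPred_forall]
    refine MeasurableSet.iInter fun A => MeasurableSet.iInter fun hA => ?_
    exact (Finset.measurable_sum _ fun σ _ => measurable_pi_apply σ) (hS A hA)
  set E : Set Config := ⋂ A ∈ t, (fun ω : Config => ω.toMeasure A) ⁻¹' S A with hE
  have hEm : MeasurableSet E := Finset.measurableSet_biInter _ fun A hA =>
    measurable_toMeasure_apply (ht A hA) (hS A hA)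
  have hfE : ∀ ω, f (fun i => (Config.toMeasure ω) (C i)) = E.indicator 1 ω := by
    intro ω
    simp only [f]
    rw [Set.indicator_apply, Set.indicator_apply]
    refine if_congr ?_ rfl rfl
    simp only [Set.mem_ofPred_eq, hE, Set.mem_iInter, Set.mem_preimage]
    constructor
    · intro h A hA
      have := h ⟨A, Finset.mem_insert_of_mem hA⟩ hA
      rwa [← hsum] at this
    · intro h A hA
      rw [← hsum]
      exact h A hA
  have hBT : B ∈ T := Finset.mem_insert_self _ _
  have hBU : B = ⋃ σ ∈ Finset.univ.filter (fun σ : T → Prop => σ ⟨B, hBT⟩), C σ := by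
    ext p
    simp [C, φ]
  have hfin : ∀ σ ∈ Finset.univ.filter (fun σ : T → Prop => σ ⟨B, hBT⟩), m (C σ) ≠ ∞ := by
    intro σ hσ
    refine ne_top_of_le_ne_top hmB (measure_mono fun p hp => ?_)
    rw [hBU]
    exact Set.mem_biUnion hσ hp
  have h1 : ∫⁻ p in B, P (shift p ⁻¹' E) ∂m =
      ∑ σ ∈ Finset.univ.filter (fun σ : T → Prop => σ ⟨B, hBT⟩),
        ∫⁻ p in C σ, P (shift p ⁻¹' E) ∂m := by
    nth_rewrite 1 [hBU]
    exact lintegral_biUnion_finset (fun σ _ τ _ h => hd h) (fun σ _ => hC σ) _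
  rw [h1, ← lintegral_indicator hEm]
  have h2 : ∀ ω : Config, E.indicator (fun ω => ω.toMeasure B) ω =
      ∑ σ ∈ Finset.univ.filter (fun σ : T → Prop => σ ⟨B, hBT⟩),
        ω.toMeasure (C σ) * f (fun i => ω.toMeasure (C i)) := by
    intro ω
    simp only [hfE]
    rw [← Finset.sum_mul, ← hsum ⟨B, hBT⟩]
    by_cases h : ω ∈ E <;> simp [h]
  simp only [h2]
  rw [lintegral_finsetSum']
  · refine Finset.sum_congr rfl fun σ hσ => ?_
    rw [hP.lintegral_cylinder C hC hd σ (hfin σ hσ) (measurable_one.indicator hset)]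
    refine lintegral_congr fun p => ?_
    have hs : Measurable (shift p) := measurable_shift.comp measurable_prodMk_right
    rw [← lintegral_indicator_one (hs hEm)]
    exact lintegral_congr fun ω => (hfE _).trans rfl
  · intro σ _
    exact ((measurable_toMeasure_apply (hC σ)).mul ((measurable_one.indicator hset).comp
      (measurable_pi_iff.2 fun i => measurable_toMeasure_apply (hC i)))).aemeasurable

/-- Provides the π-system, stable under finite intersections, on which the two sides of the Mecke
formula are compared. -/
theorem measurableSpace_config_eq_generateFrom :
    instMeasurableSpaceConfig = MeasurableSpace.generateFrom (piiUnionInter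
      (fun A : Set Mark => {E | ∃ S, MeasurableSet S ∧ (fun ω : Config => ω.toMeasure A) ⁻¹' S = E})
      {A | MeasurableSet A}) := by
  have h := generateFrom_piiUnionInter_measurableSet
    (fun A : Set Mark => MeasurableSpace.comap (fun ω : Config => ω.toMeasure A) inferInstance)
    {A | MeasurableSet A}
  refine Eq.trans ?_ h.symm
  rw [instMeasurableSpaceConfig, Measure.instMeasurableSpace]
  simp only [MeasurableSpace.comap_iSup, MeasurableSpace.comap_comp]
  rfl

theorem compProd_countingKernel_prod [SFinite P] {E : Set Config} (hE : MeasurableSet E)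
    {B : Set Mark} (hB : MeasurableSet B) :
    (P ⊗ₘ countingKernel) (E ×ˢ B) = ∫⁻ ω in E, ω.toMeasure B ∂P :=
  Measure.compProd_apply_prod hE hB

theorem map_shift_prod [SFinite P] [SFinite m] {E : Set Config} (hE : MeasurableSet E)
    {B : Set Mark} (hB : MeasurableSet B) :
    (P.prod m).map (fun q => (shift q.2 q.1, q.2)) (E ×ˢ B) =
      ∫⁻ p in B, P (shift p ⁻¹' E) ∂m := by
  have hs := measurable_shift.prodMk (measurable_snd : Measurable (Prod.snd : Config × Mark → Mark))
  rw [Measure.map_apply hs (hE.prod hB), Measure.prod_apply_symm (hs (hE.prod hB)),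
    ← lintegral_indicator hB]
  refine lintegral_congr fun p => ?_
  by_cases hp : p ∈ B
  · rw [Set.indicator_of_mem hp]
    congr 1
    ext ω
    simp [hp]
  · rw [Set.indicator_of_notMem hp, (by ext ω; simp [hp] : (fun ω : Config => (ω, p)) ⁻¹'
      ((fun q : Config × Mark => (shift q.2 q.1, q.2)) ⁻¹' E ×ˢ B) = ∅), measure_empty]

/-- The Mecke formula, as an identity of measures on `Config × Mark`. -/
theorem IsPoissonLaw.compProd_countingKernel [IsProbabilityMeasure P] [NullSingletonClass m]
    [SigmaFinite m] (hP : IsPoissonLaw P m) :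
    P ⊗ₘ countingKernel = (P.prod m).map (fun q => (shift q.2 q.1, q.2)) := by
  set M₁ := P ⊗ₘ countingKernel with hM₁
  set M₂ := (P.prod m).map (fun q => (shift q.2 q.1, q.2)) with hM₂
  have hcyl : ∀ B : Set Mark, MeasurableSet B → m B ≠ ∞ → ∀ t : Finset (Set Mark),
      (∀ A ∈ t, MeasurableSet A) → ∀ S : Set Mark → Set ℝ≥0∞, (∀ A ∈ t, MeasurableSet (S A)) →
      M₁ ((⋂ A ∈ t, (fun ω : Config => ω.toMeasure A) ⁻¹' S A) ×ˢ B) =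
        M₂ ((⋂ A ∈ t, (fun ω : Config => ω.toMeasure A) ⁻¹' S A) ×ˢ B) := by
    intro B hB hmB t ht S hS
    have hEm : MeasurableSet (⋂ A ∈ t, (fun ω : Config => ω.toMeasure A) ⁻¹' S A) :=
      Finset.measurableSet_biInter _ fun A hA => measurable_toMeasure_apply (ht A hA) (hS A hA)
    rw [hM₁, hM₂, compProd_countingKernel_prod hEm hB, map_shift_prod hEm hB,
      hP.setLIntegral_cylinder hB hmB t ht S hS]
  have huniv : ∀ B : Set Mark, MeasurableSet B → m B ≠ ∞ →
      M₁ (Set.univ ×ˢ B) = M₂ (Set.univ ×ˢ B) ∧ M₂ (Set.univ ×ˢ B) ≠ ∞ := by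
    intro B hB hmB
    constructor
    · simpa using hcyl B hB hmB ∅ (by simp) (fun _ => Set.univ) (by simp)
    · rw [hM₂, map_shift_prod MeasurableSet.univ hB]
      simpa using hmB
  have hrect : ∀ B : Set Mark, MeasurableSet B → m B ≠ ∞ → ∀ E : Set Config, MeasurableSet E →
      M₁ (E ×ˢ B) = M₂ (E ×ˢ B) := by
    intro B hB hmB E hE
    have happ : ∀ (M : Measure (Config × Mark)) (E : Set Config), MeasurableSet E →
        (M.restrict (Set.univ ×ˢ B)).map Prod.fst E = M (E ×ˢ B) := by
      intro M E hE
      rw [Measure.map_apply measurable_fst hE, Measure.restrict_apply (measurable_fst hE)]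
      congr 1
      ext q
      simp
    have hfin : IsFiniteMeasure ((M₁.restrict (Set.univ ×ˢ B)).map Prod.fst) := ⟨by
      rw [happ _ _ MeasurableSet.univ, (huniv B hB hmB).1]
      exact (huniv B hB hmB).2.lt_top⟩
    rw [← happ M₁ E hE, ← happ M₂ E hE]
    congr 1
    -- For a fixed `B` of finite intensity both sides are finite measures in `E`, so agreement on
    -- the π-system of count events is enough.
    refine ext_of_generate_finite _ measurableSpace_config_eq_generateFrom
      (isPiSystem_piiUnionInter _ (fun A => ?_) _) ?_ ?_
    · exact @MeasurableSpace.isPiSystem_measurableSet _ (MeasurableSpace.comap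
        (fun ω : Config => ω.toMeasure A) inferInstance)
    · rintro _ ⟨t, ht, f, hf, rfl⟩
      choose! S hS hSf using hf
      have hE : (⋂ A ∈ t, f A) = ⋂ A ∈ t, (fun ω : Config => ω.toMeasure A) ⁻¹' S A :=
        Set.iInter₂_congr fun A hA => (hSf A hA).symm
      have hEm : MeasurableSet (⋂ A ∈ t, (fun ω : Config => ω.toMeasure A) ⁻¹' S A) :=
        Finset.measurableSet_biInter _ fun A hA =>
          measurable_toMeasure_apply (ht hA) (hS A hA)
      rw [hE, happ _ _ hEm, happ _ _ hEm]
      exact hcyl B hB hmB t (fun A hA => ht hA) S hS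
    · rw [happ _ _ MeasurableSet.univ, happ _ _ MeasurableSet.univ]
      exact (huniv B hB hmB).1
  -- The finiteness of `m B` is removed by exhausting the mark space with sets of finite intensity.
  refine Measure.ext_of_iUnion_eq_univ (s := fun n => Set.univ ×ˢ spanningSets m n) ?_ fun n => ?_
  · rw [← Set.prod_iUnion, iUnion_spanningSets, Set.univ_prod_univ]
  · have hBm := measurableSet_spanningSets m n
    have hmB := (measure_spanningSets_lt_top m n).ne
    have : IsFiniteMeasure (M₁.restrict (Set.univ ×ˢ spanningSets m n)) := ⟨by
      rw [Measure.restrict_apply_univ, (huniv _ hBm hmB).1]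
      exact (huniv _ hBm hmB).2.lt_top⟩
    refine Measure.ext_prod fun {s t} hs ht => ?_
    rw [Measure.restrict_apply (hs.prod ht), Measure.restrict_apply (hs.prod ht),
      Set.prod_inter_prod, Set.inter_univ]
    exact hrect _ (ht.inter hBm) (ne_top_of_le_ne_top hmB (measure_mono Set.inter_subset_right)) s hs

theorem measurable_shift_prodMk : Measurable fun q : Config × Mark => (shift q.2 q.1, q.2) :=
  measurable_shift.prodMk measurable_snd

/-- The Mecke formula for nonnegative integrands. -/
theorem IsPoissonLaw.lintegral_mecke [IsProbabilityMeasure P] [NullSingletonClass m]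
    [SigmaFinite m] (hP : IsPoissonLaw P m) {u : Config × Mark → ℝ≥0∞} (hu : Measurable u) :
    ∫⁻ ω, ∫⁻ p, u (ω, p) ∂ω.toMeasure ∂P = ∫⁻ ω, ∫⁻ p, u (shift p ω, p) ∂m ∂P := by
  have h := Measure.lintegral_compProd (μ := P) (κ := countingKernel) hu
  rw [hP.compProd_countingKernel, lintegral_map hu measurable_shift_prodMk,
    lintegral_prod (fun q : Config × Mark => u (shift q.2 q.1, q.2))
      (hu.comp measurable_shift_prodMk).aemeasurable] at h
  exact h.symm

theorem IsPoissonLaw.integrable_mecke [IsProbabilityMeasure P] [NullSingletonClass m]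
    [SigmaFinite m] (hP : IsPoissonLaw P m) {u : Config × Mark → ℝ} (hu : Measurable u) :
    Integrable u (P ⊗ₘ countingKernel) ↔
      Integrable (fun q : Config × Mark => u (shift q.2 q.1, q.2)) (P.prod m) := by
  rw [hP.compProd_countingKernel,
    integrable_map_measure hu.aestronglyMeasurable measurable_shift_prodMk.aemeasurable]
  rfl

/-- The Mecke formula for integrable integrands. -/
theorem IsPoissonLaw.integral_mecke [IsProbabilityMeasure P] [NullSingletonClass m]
    [SigmaFinite m] (hP : IsPoissonLaw P m) {u : Config × Mark → ℝ} (hu : Measurable u)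
    (hi : Integrable (fun q : Config × Mark => u (shift q.2 q.1, q.2)) (P.prod m)) :
    ∫ ω, ∫ p, u (ω, p) ∂ω.toMeasure ∂P =
      ∫ q : Config × Mark, u (shift q.2 q.1, q.2) ∂P.prod m := by
  have h := Measure.integral_compProd (μ := P) (κ := countingKernel) ((hP.integrable_mecke hu).2 hi)
  rw [hP.compProd_countingKernel,
    integral_map measurable_shift_prodMk.aemeasurable hu.aestronglyMeasurable] at h
  exact h.symm

end Poisson

/-! ### Adding a point to a configuration -/

theorem shift_of_mem {p : Mark} {ω : Config} (hp : p ∈ ω.points) : shift p ω = ω := by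
  ext1
  exact Set.insert_eq_of_mem hp

theorem shift_comm (p q : Mark) (ω : Config) : shift p (shift q ω) = shift q (shift p ω) := by
  ext1
  exact Set.insert_comm _ _ _

theorem lintegral_shift_of_notMem {p : Mark} {ω : Config} (hp : p ∉ ω.points) (f : Mark → ℝ≥0∞) :
    ∫⁻ q, f q ∂(shift p ω).toMeasure = ∫⁻ q, f q ∂ω.toMeasure + f p := by
  rw [toMeasure_shift_of_notMem hp, lintegral_add_measure, lintegral_dirac]

theorem lintegral_shift_of_eq_zero {p : Mark} {f : Mark → ℝ≥0∞} (hf : f p = 0) (ω : Config) :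
    ∫⁻ q, f q ∂(shift p ω).toMeasure = ∫⁻ q, f q ∂ω.toMeasure := by
  by_cases hp : p ∈ ω.points
  · rw [shift_of_mem hp]
  · rw [lintegral_shift_of_notMem hp, hf, add_zero]

-- Adding an atom cannot restore integrability, so the default value `0` of the Bochner integral
-- persists. This keeps statements about `X` valid for every configuration, not only almost surely.
open Classical in
theorem integral_shift_of_notMem {p : Mark} {ω : Config} (hp : p ∉ ω.points) (f : Mark → ℝ) :
    ∫ q, f q ∂(shift p ω).toMeasure =
      if Integrable f ω.toMeasure then ∫ q, f q ∂ω.toMeasure + f p else 0 := by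
  rw [toMeasure_shift_of_notMem hp]
  split_ifs with h
  · rw [integral_add_measure h (integrable_dirac (by simp)), integral_dirac]
  · exact integral_undef fun h' => h h'.left_of_add_measure

theorem integral_shift_of_eq_zero {p : Mark} {f : Mark → ℝ} (hf : f p = 0) (ω : Config) :
    ∫ q, f q ∂(shift p ω).toMeasure = ∫ q, f q ∂ω.toMeasure := by
  by_cases hp : p ∈ ω.points
  · rw [shift_of_mem hp]
  · rw [integral_shift_of_notMem hp, hf, add_zero]
    split_ifs with h
    · rfl
    · exact (integral_undef h).symm

/-! ### The Hawkes process does not anticipate -/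

section Hawkes

variable (μ : ℝ≥0) (Φ : ℝ≥0 → ℝ≥0)

/-- The inequality `p.1 < t` in the iteration is strict, so a point at time `t` or later has no
weight in $\lambda_t$; the acceptance of the other points is decided at earlier times. -/
theorem picard_shift (n : ℕ) {p : Mark} (ω : Config) {t : ℝ≥0} (h : t ≤ p.1) :
    picard μ Φ n (shift p ω) t = picard μ Φ n ω t := by
  induction n generalizing t with
  | zero => rfl
  | succ n ih =>
    rw [picard, picard, lintegral_shift_of_eq_zero (if_neg fun h' => h.not_gt h'.2.1)]
    congr 1
    refine lintegral_congr fun q => ?_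
    refine if_congr (and_congr_right fun _ => and_congr_right fun h1 => ?_) rfl rfl
    rw [ih (h1.le.trans h)]

theorem hawkesIntensity_shift {p : Mark} (ω : Config) {t : ℝ≥0} (h : t ≤ p.1) :
    hawkesIntensity μ Φ (shift p ω) t = hawkesIntensity μ Φ ω t :=
  iSup_congr fun n => picard_shift μ Φ n ω h

/-- Here `s < p.1` must be strict, because $X_s$ includes a jump at time `s`. The case `s = 0`,
where the interval of integration is empty, serves the time-zero generators of the predictable
σ-field. -/
theorem compoundHawkes_shift {p : Mark} (ω : Config) {s : ℝ≥0} (h : s = 0 ∨ s < p.1) :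
    compoundHawkes μ Φ s (shift p ω) = compoundHawkes μ Φ s ω := by
  rw [compoundHawkes, compoundHawkes, integral_shift_of_eq_zero]
  · refine integral_congr_ae (Filter.Eventually.of_forall fun q => ?_)
    refine if_congr (and_congr_right fun h0 => and_congr_right fun h1 => ?_) rfl rfl
    rw [hawkesIntensity_shift μ Φ ω]
    rcases h with rfl | h
    · exact absurd h0 h1.not_gt
    · exact h1.trans h.le
  · refine if_neg fun h' => ?_
    rcases h with rfl | h
    · exact h'.2.1.not_gt h'.1
    · exact h'.2.1.not_gt h

variable {μ Φ}

/-- A comparison with delay. After `n₀` iterations the point `(t, θ', x')` is accepted, and its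
weight `Φ (s - t)` depends on neither `θ'` nor `x'`; so the system with `(t, θ', x')`, run `n₀`
steps longer, dominates the one with `(t, θ, x)`. Applied both ways, it makes the limits equal. -/
theorem picard_shift_le_picard_shift {n₀ : ℕ} {ω : Config} {t θ θ' : ℝ≥0} {x x' : ℝ}
    (hθ' : (θ' : ℝ≥0∞) ≤ picard μ Φ n₀ ω t)
    (h : (t, θ, x) ∉ ω.points) (h' : (t, θ', x') ∉ ω.points) (n : ℕ) (s : ℝ≥0) :
    picard μ Φ n (shift (t, θ, x) ω) s ≤ picard μ Φ (n + n₀) (shift (t, θ', x') ω) s := by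
  induction n generalizing s with
  | zero => exact (picard_mono μ Φ _ s (Nat.zero_le (0 + n₀)))
  | succ n ih =>
    rw [Nat.succ_add, picard, picard, lintegral_shift_of_notMem h, lintegral_shift_of_notMem h']
    refine add_le_add le_rfl (add_le_add (lintegral_mono fun q => ?_) ?_)
    · dsimp only
      split_ifs with h1 h2
      · exact le_rfl
      · exact absurd ⟨h1.1, h1.2.1, h1.2.2.trans (ih _)⟩ h2
      · exact zero_le
      · exact le_rfl
    · dsimp only
      split_ifs with h1 h2
      · exact le_rfl
      · refine absurd ⟨h1.1, h1.2.1, ?_⟩ h2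
        rw [picard_shift μ Φ _ ω le_rfl]
        exact hθ'.trans (picard_mono μ Φ ω t (Nat.le_add_left n₀ n))
      · exact zero_le
      · exact le_rfl

theorem hawkesIntensity_shift_eq_shift {n₀ : ℕ} {ω : Config} {t θ θ' : ℝ≥0} {x x' : ℝ}
    (hθ : (θ : ℝ≥0∞) ≤ picard μ Φ n₀ ω t) (hθ' : (θ' : ℝ≥0∞) ≤ picard μ Φ n₀ ω t)
    (h : (t, θ, x) ∉ ω.points) (h' : (t, θ', x') ∉ ω.points) :
    hawkesIntensity μ Φ (shift (t, θ, x) ω) = hawkesIntensity μ Φ (shift (t, θ', x') ω) := by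
  ext s
  refine le_antisymm (iSup_le fun n => ?_) (iSup_le fun n => ?_)
  · exact (picard_shift_le_picard_shift hθ' h h' n s).trans
      (le_iSup (fun n => picard μ Φ n _ s) (n + n₀))
  · exact (picard_shift_le_picard_shift hθ h' h n s).trans
      (le_iSup (fun n => picard μ Φ n _ s) (n + n₀))

/-- Two accepted points with the same time and the same jump size have the same effect on `X`. -/
theorem compoundHawkes_shift_eq_shift {n₀ : ℕ} {ω : Config} {t θ θ' : ℝ≥0} {x : ℝ}
    (hθ : (θ : ℝ≥0∞) ≤ picard μ Φ n₀ ω t) (hθ' : (θ' : ℝ≥0∞) ≤ picard μ Φ n₀ ω t)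
    (h : (t, θ, x) ∉ ω.points) (h' : (t, θ', x) ∉ ω.points) (s : ℝ≥0) :
    compoundHawkes μ Φ s (shift (t, θ, x) ω) = compoundHawkes μ Φ s (shift (t, θ', x) ω) := by
  have hle : picard μ Φ n₀ ω t ≤ hawkesIntensity μ Φ (shift (t, θ', x) ω) t := by
    rw [hawkesIntensity_shift μ Φ ω le_rfl]
    exact le_iSup (fun n => picard μ Φ n ω t) n₀
  rw [compoundHawkes, compoundHawkes, integral_shift_of_notMem h, integral_shift_of_notMem h',
    hawkesIntensity_shift_eq_shift hθ hθ' h h']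
  simp only [hθ.trans hle, hθ'.trans hle]

/-- Before explosion, the Picard iterates are eventually stationary. -/
theorem exists_hawkesIntensity_eq_picard {ω : Config} {t : ℝ≥0} (h : hawkesCount μ Φ t ω < ∞) :
    ∃ n, hawkesIntensity μ Φ ω t = picard μ Φ n ω t ∧ hawkesIntensity μ Φ ω t < ∞ := by
  set S : Set Mark := {p | p ∈ ω.points ∧ 0 < p.1 ∧ p.1 ≤ t ∧
    (p.2.1 : ℝ≥0∞) ≤ hawkesIntensity μ Φ ω p.1} with hS
  have hsub : {p : ω.points | 0 < (p : Mark).1 ∧ (p : Mark).1 ≤ t ∧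
      ((p : Mark).2.1 : ℝ≥0∞) ≤ hawkesIntensity μ Φ ω (p : Mark).1}.Finite := by
    rw [hawkesCount, ω.lintegral] at h
    refine (ENNReal.finite_const_le_of_tsum_ne_top h.ne one_ne_zero).subset fun p hp => ?_
    change (1 : ℝ≥0∞) ≤ if _ then _ else _
    exact (if_pos hp).ge
  have hfin : S.Finite := (hsub.image Subtype.val).subset fun p hp => ⟨⟨p, hp.1⟩, hp.2, rfl⟩
  -- Only finitely many points are ever accepted up to time `t`, each by some iterate; from a common
  -- index on, every acceptance is settled.
  have hev : ∀ᶠ n in Filter.atTop, ∀ p ∈ S, ((p.2.1 : ℝ≥0∞) ≤ picard μ Φ n ω p.1 ↔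
      ∃ m, (p.2.1 : ℝ≥0∞) ≤ picard μ Φ m ω p.1) := by
    refine (Filter.eventually_all_finite hfin).2 fun p _ => ?_
    by_cases hp : ∃ m, (p.2.1 : ℝ≥0∞) ≤ picard μ Φ m ω p.1
    · obtain ⟨m, hm⟩ := hp
      filter_upwards [Filter.eventually_ge_atTop m] with n hn
      exact ⟨fun h => ⟨n, h⟩, fun _ => hm.trans (picard_mono μ Φ ω p.1 hn)⟩
    · exact Filter.Eventually.of_forall fun n => ⟨fun h => ⟨n, h⟩, fun h => absurd h hp⟩
  obtain ⟨N, hN⟩ := Filter.eventually_atTop.1 hev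
  have key : ∀ n ≥ N, picard μ Φ (n + 1) ω t = picard μ Φ (N + 1) ω t := by
    intro n hn
    rw [picard, picard, ω.lintegral, ω.lintegral]
    congr 1
    refine tsum_congr fun p => ?_
    refine if_congr (and_congr_right fun h0 => and_congr_right fun h1 => ?_) rfl rfl
    by_cases hp : (p : Mark) ∈ S
    · rw [hN n hn p hp, hN N le_rfl p hp]
    · have hlt : ∀ k, ¬ ((p : Mark).2.1 : ℝ≥0∞) ≤ picard μ Φ k ω (p : Mark).1 := fun k hk =>
        hp ⟨p.2, h0, h1.le, hk.trans (le_iSup (fun n => picard μ Φ n ω _) k)⟩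
      simp [hlt]
  have heq : hawkesIntensity μ Φ ω t = picard μ Φ (N + 1) ω t := by
    refine le_antisymm (iSup_le fun n => ?_) (le_iSup (fun n => picard μ Φ n ω t) (N + 1))
    rw [← key (max n N) (le_max_right _ _)]
    exact picard_mono μ Φ ω t ((le_max_left n N).trans (Nat.le_succ _))
  refine ⟨N + 1, heq, ?_⟩
  rw [hawkesIntensity_eq μ Φ ω t h, ω.lintegral, tsum_eq_sum (s := hsub.toFinset)]
  · refine ENNReal.add_lt_top.2 ⟨ENNReal.coe_lt_top, ENNReal.sum_lt_top.2 fun p _ => ?_⟩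
    split_ifs <;> simp
  · intro p hp
    refine if_neg fun h' => hp ?_
    exact hsub.mem_toFinset.2 ⟨h'.1, h'.2.1.le, h'.2.2⟩

end Hawkes

/-! ### Measurability and invariance -/

/-- The σ-field of all sets that do not separate two given points. -/
@[reducible]
def nonseparating {α : Type*} (a b : α) : MeasurableSpace α where
  MeasurableSet' A := a ∈ A ↔ b ∈ A
  measurableSet_empty := by simp
  measurableSet_compl A hA := by simp [hA]
  measurableSet_iUnion A hA := by simp [hA]

theorem comap_le_nonseparating {α β : Type*} [MeasurableSpace β] {f : α → β} {a b : α}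
    (h : f a = f b) : MeasurableSpace.comap f inferInstance ≤ nonseparating a b := by
  rintro _ ⟨S, _, rfl⟩
  change f a ∈ S ↔ f b ∈ S
  rw [h]

/-- The fibre of `f` through `a` is measurable, hence contains `b`. This replaces a factorization of
`f` through the generating process. -/
theorem eq_of_measurable_nonseparating {α β : Type*} [MeasurableSpace β]
    [MeasurableSingletonClass β] {m : MeasurableSpace α} {a b : α} (hm : m ≤ nonseparating a b)
    {f : α → β} (hf : Measurable[m] f) : f a = f b :=
  ((hm _ (hf (measurableSet_singleton (f a)))).1 rfl).symm

section Filtration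

variable {μ : ℝ≥0} {Φ : ℝ≥0 → ℝ≥0} (hΦ : Measurable Φ)

theorem filtrationX_le_nonseparating {ω₁ ω₂ : Config} {t : ℝ≥0}
    (h : ∀ s ≤ t, compoundHawkes μ Φ s ω₁ = compoundHawkes μ Φ s ω₂) :
    filtrationX μ hΦ t ≤ nonseparating ω₁ ω₂ := by
  rw [filtrationX, Filtration.natural]
  refine iSup₂_le fun s hs => ?_
  exact comap_le_nonseparating (h s hs)

theorem eq_of_measurable_sigmaX {F : Config → ℝ} (hF : Measurable[sigmaX μ hΦ] F) {ω₁ ω₂ : Config}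
    (h : ∀ s, compoundHawkes μ Φ s ω₁ = compoundHawkes μ Φ s ω₂) : F ω₁ = F ω₂ :=
  eq_of_measurable_nonseparating
    (iSup_le fun _ => filtrationX_le_nonseparating hΦ fun s _ => h s) hF

/-- It suffices to check the generators $\{0\}\times A$ with $A\in\mathcal F^X_0$ and
$(i,\infty)\times A$ with $A\in\mathcal F^X_i$. In the second case $i<t\le$ the time of `p`, so $X$
up to time `i` does not see `p`. -/
theorem predictable_le_nonseparating {p : Mark} (ω : Config) {t : ℝ≥0} (h : t ≤ p.1) :
    (filtrationX μ hΦ).predictable ≤ nonseparating (t, shift p ω) (t, ω) := by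
  refine MeasurableSpace.generateFrom_le ?_
  rintro _ (⟨A, hA, rfl⟩ | ⟨i, A, hA, rfl⟩)
  · have := filtrationX_le_nonseparating hΦ (ω₁ := shift p ω) (ω₂ := ω) (t := ⊥)
      (fun s hs => compoundHawkes_shift μ Φ ω (Or.inl (le_bot_iff.1 hs))) A hA
    exact and_congr_right fun _ => this
  · refine and_congr_right fun hi => ?_
    exact filtrationX_le_nonseparating hΦ (ω₁ := shift p ω) (ω₂ := ω) (t := i)
      (fun s hs => compoundHawkes_shift μ Φ ω (Or.inr ((hs.trans_lt hi).trans_le h))) A hA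

theorem predictable_le_prod : (filtrationX μ hΦ).predictable ≤ Prod.instMeasurableSpace := by
  refine MeasurableSpace.generateFrom_le ?_
  rintro _ (⟨A, hA, rfl⟩ | ⟨i, A, hA, rfl⟩)
  · exact (measurableSet_singleton _).prod ((filtrationX μ hΦ).le _ _ hA)
  · exact measurableSet_Ioi.prod ((filtrationX μ hΦ).le _ _ hA)

variable {hΦ} {Z : ℝ≥0 → ℝ → Config → ℝ}

theorem IsMarkedPredictable.apply_shift (hZ : IsMarkedPredictable (filtrationX μ hΦ) Z) {p : Mark}
    (ω : Config) {t : ℝ≥0} (h : t ≤ p.1) (x : ℝ) : Z t x (shift p ω) = Z t x ω := by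
  refine eq_of_measurable_nonseparating (a := ((t, shift p ω), x)) (b := ((t, ω), x)) ?_ hZ
  refine sup_le ?_ ?_
  · rintro _ ⟨A, hA, rfl⟩
    exact predictable_le_nonseparating hΦ ω h A hA
  · exact comap_le_nonseparating rfl

theorem IsMarkedPredictable.measurable (hZ : IsMarkedPredictable (filtrationX μ hΦ) Z) :
    Measurable fun q : (ℝ≥0 × Config) × ℝ => Z q.1.1 q.2 q.1.2 :=
  hZ.mono (sup_le_sup (MeasurableSpace.comap_mono (predictable_le_prod hΦ)) le_rfl) le_rfl

end Filtration


/-! ### Integrating out the thinning variable -/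

theorem lebesgue_setOf_coe_le (L : ℝ≥0∞) : lebesgue {θ : ℝ≥0 | (θ : ℝ≥0∞) ≤ L} = L := by
  induction L with
  | top =>
    simp only [le_top, Set.ofPred_true]
    refine ENNReal.eq_top_of_forall_nnreal_le fun r => ?_
    rw [← lebesgue_Iic r]
    exact measure_mono (Set.subset_univ _)
  | coe L =>
    simp only [ENNReal.coe_le_coe]
    exact lebesgue_Iic L

theorem lintegral_lebesgue (f : ℝ≥0 → ℝ≥0∞) :
    ∫⁻ t, f t ∂lebesgue = ∫⁻ x in Set.Ici (0 : ℝ), f x.toNNReal := by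
  have he : MeasurableEmbedding NNReal.toReal := MeasurableEmbedding.subtype_coe measurableSet_Ici
  have h : lebesgue.map NNReal.toReal = volume.restrict (Set.Ici (0 : ℝ)) := by
    rw [lebesgue, he.map_comap]
    congr 1
    ext x
    simp [NNReal.range_coe]
  rw [← h, he.lintegral_map]
  simp

/-- The reflection $u=t-s$ preserves Lebesgue measure on ℝ, to which both functions are extended by
zero. -/
theorem setLIntegral_Iio_comp_sub_le (f : ℝ≥0 → ℝ≥0∞) (t : ℝ≥0) :
    ∫⁻ s in Set.Iio t, f (t - s) ∂lebesgue ≤ ∫⁻ u, f u ∂lebesgue := by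
  rw [← lintegral_indicator measurableSet_Iio, lintegral_lebesgue, lintegral_lebesgue,
    ← lintegral_indicator measurableSet_Ici, ← lintegral_indicator measurableSet_Ici,
    ← lintegral_sub_left_eq_self (fun x => (Set.Ici (0 : ℝ)).indicator (fun x => f x.toNNReal) x)
      (t : ℝ)]
  refine lintegral_mono fun x => ?_
  by_cases hx : x ∈ Set.Ici (0 : ℝ)
  · rw [Set.indicator_of_mem hx]
    by_cases hxt : x.toNNReal ∈ Set.Iio t
    · rw [Set.indicator_of_mem hxt, Set.indicator_of_mem]
      · have hx' : ((x.toNNReal : ℝ≥0) : ℝ) = x := Real.coe_toNNReal x hx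
        have : t - x.toNNReal = ((t : ℝ) - x).toNNReal := by
          rw [← NNReal.coe_inj, NNReal.coe_sub (le_of_lt hxt), hx', Real.coe_toNNReal]
          rw [sub_nonneg, ← hx']
          exact_mod_cast (le_of_lt hxt)
        rw [this]
      · have : x.toNNReal ≤ t := le_of_lt hxt
        simpa [Real.toNNReal_le_iff_le_coe] using this
    · rw [Set.indicator_of_notMem hxt]
      exact zero_le
  · rw [Set.indicator_of_notMem hx]
    exact zero_le

section Thinning

variable (ν : Measure ℝ) [IsProbabilityMeasure ν]

/-- The intensity measure is `dt ⊗ ν(dx) ⊗ dθ` up to a permutation of the coordinates. -/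
theorem measurePreserving_intensityMeasure :
    MeasurePreserving (fun q : (ℝ≥0 × ℝ) × ℝ≥0 => ((q.1.1, q.2, q.1.2) : Mark))
      ((lebesgue.prod ν).prod lebesgue) (intensityMeasure ν) := by
  have h1 : MeasurePreserving (MeasurableEquiv.prodAssoc : (ℝ≥0 × ℝ) × ℝ≥0 ≃ᵐ ℝ≥0 × ℝ × ℝ≥0)
      ((lebesgue.prod ν).prod lebesgue) (lebesgue.prod (ν.prod lebesgue)) :=
    measurePreserving_prodAssoc _ _ _
  have h2 : MeasurePreserving (Prod.map id Prod.swap : ℝ≥0 × ℝ × ℝ≥0 → Mark)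
      (lebesgue.prod (ν.prod lebesgue)) (intensityMeasure ν) :=
    (MeasurePreserving.id _).prod Measure.measurePreserving_swap
  exact h2.comp h1

theorem lintegral_intensityMeasure {f : Mark → ℝ≥0∞} (hf : Measurable f) :
    ∫⁻ p, f p ∂intensityMeasure ν =
      ∫⁻ q, ∫⁻ θ, f (q.1, θ, q.2) ∂lebesgue ∂(lebesgue.prod ν) := by
  rw [← (measurePreserving_intensityMeasure ν).lintegral_comp hf]
  exact lintegral_prod _ (hf.comp (measurePreserving_intensityMeasure ν).measurable).aemeasurable

/-- The interval of accepted `θ` has length `L t`. The form of `f` is required for almost every `t`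
only, since the Malliavin derivative is constant in `θ` only off the jump times of the
configuration. -/
theorem lintegral_intensityMeasure_of_eq_ite {L : ℝ≥0 → ℝ≥0∞} {f : Mark → ℝ≥0∞}
    (hf : Measurable f) {g : ℝ≥0 × ℝ → ℝ≥0∞}
    (hfg : ∀ᵐ t ∂lebesgue, ∀ x θ, f (t, θ, x) = if (θ : ℝ≥0∞) ≤ L t then g (t, x) else 0) :
    ∫⁻ p, f p ∂intensityMeasure ν = ∫⁻ q, g q * L q.1 ∂(lebesgue.prod ν) := by
  rw [lintegral_intensityMeasure ν hf]
  refine lintegral_congr_ae ?_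
  filter_upwards [Measure.quasiMeasurePreserving_fst.ae hfg] with q hq
  have : (fun θ : ℝ≥0 => f (q.1, θ, q.2)) =
      Set.indicator {θ : ℝ≥0 | (θ : ℝ≥0∞) ≤ L q.1} fun _ => g q := by
    ext θ
    simp [Set.indicator_apply, hq]
  rw [this, lintegral_indicator_const (measurableSet_le (by fun_prop) measurable_const),
    lebesgue_setOf_coe_le]

theorem lintegral_thinned {L : ℝ≥0 → ℝ≥0∞} (hL : Measurable L) {g : ℝ≥0 × ℝ → ℝ≥0∞}
    (hg : Measurable g) :
    ∫⁻ p, (if (p.2.1 : ℝ≥0∞) ≤ L p.1 then g (p.1, p.2.2) else 0) ∂intensityMeasure ν =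
      ∫⁻ q, g q * L q.1 ∂(lebesgue.prod ν) :=
  lintegral_intensityMeasure_of_eq_ite ν (Measurable.ite
    (measurableSet_le (by fun_prop) (by fun_prop)) (by fun_prop) measurable_const)
    (Filter.Eventually.of_forall fun _ _ _ => rfl)

theorem integral_intensityMeasure_of_eq_ite {L : ℝ≥0 → ℝ≥0∞} {f : Mark → ℝ}
    (hf : Integrable f (intensityMeasure ν)) {g : ℝ≥0 × ℝ → ℝ}
    (hfg : ∀ᵐ t ∂lebesgue, ∀ x θ, f (t, θ, x) = if (θ : ℝ≥0∞) ≤ L t then g (t, x) else 0) :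
    ∫ p, f p ∂intensityMeasure ν = ∫ q, (L q.1).toReal * g q ∂(lebesgue.prod ν) := by
  have hmp := measurePreserving_intensityMeasure ν
  rw [← hmp.map_eq, integral_map hmp.measurable.aemeasurable (hmp.map_eq.symm ▸ hf.1),
    integral_prod (fun q : (ℝ≥0 × ℝ) × ℝ≥0 => f (q.1.1, q.2, q.1.2))
      (hmp.integrable_comp_of_integrable hf)]
  refine integral_congr_ae ?_
  filter_upwards [Measure.quasiMeasurePreserving_fst.ae hfg] with q hq
  have : (fun θ : ℝ≥0 => f (q.1, θ, q.2)) =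
      Set.indicator {θ : ℝ≥0 | (θ : ℝ≥0∞) ≤ L q.1} fun _ => g q := by
    ext θ
    simp [Set.indicator_apply, hq]
  rw [this, integral_indicator_const _ (measurableSet_le (by fun_prop) measurable_const),
    measureReal_def, lebesgue_setOf_coe_le, smul_eq_mul]

end Thinning

/-! ### The first moment of the intensity -/

section Moment

variable {ν : Measure ℝ} [IsProbabilityMeasure ν] {P : Measure Config} [IsProbabilityMeasure P]
  {μ : ℝ≥0} {Φ : ℝ≥0 → ℝ≥0}

/-- By Mecke and `hLs`, accepted points have conditional intensity `L`; `θ` is integrated out and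
Tonelli moves the expectation inside. -/
theorem IsPoissonLaw.lintegral_thinned (hP : IsPoissonLaw P (intensityMeasure ν))
    {L : Config → ℝ≥0 → ℝ≥0∞} (hL : Measurable fun q : Config × ℝ≥0 => L q.1 q.2)
    (hLs : ∀ p ω, L (shift p ω) p.1 = L ω p.1) {g : ℝ≥0 × ℝ → ℝ≥0∞} (hg : Measurable g) :
    ∫⁻ ω, ∫⁻ p, (if (p.2.1 : ℝ≥0∞) ≤ L ω p.1 then g (p.1, p.2.2) else 0) ∂ω.toMeasure ∂P =
      ∫⁻ q, g q * ∫⁻ ω, L ω q.1 ∂P ∂(lebesgue.prod ν) := by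
  rw [hP.lintegral_mecke (u := fun q : Config × Mark =>
    if (q.2.2.1 : ℝ≥0∞) ≤ L q.1 q.2.1 then g (q.2.1, q.2.2.2) else 0)]
  · simp only [hLs]
    have h1 : ∀ ω, ∫⁻ p, (if (p.2.1 : ℝ≥0∞) ≤ L ω p.1 then g (p.1, p.2.2) else 0)
        ∂intensityMeasure ν = ∫⁻ q, g q * L ω q.1 ∂(lebesgue.prod ν) := fun ω =>
      HawkesIBP.lintegral_thinned ν (hL.comp measurable_prodMk_left) hg
    simp only [h1]
    have hL' : Measurable fun q : Config × (ℝ≥0 × ℝ) => L q.1 q.2.1 :=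
      hL.comp (f := fun q : Config × (ℝ≥0 × ℝ) => (q.1, q.2.1)) (by fun_prop)
    rw [lintegral_lintegral_swap]
    · refine lintegral_congr fun q => ?_
      rw [lintegral_const_mul]
      exact hL.comp (f := fun ω => (ω, q.1)) (by fun_prop)
    · exact ((hg.comp measurable_snd).mul hL').aemeasurable
  · refine Measurable.ite (measurableSet_le (f := fun q : Config × Mark => (q.2.2.1 : ℝ≥0∞))
      (by fun_prop) ?_) (by fun_prop) measurable_const
    exact hL.comp (f := fun q : Config × Mark => (q.1, q.2.1)) (by fun_prop)

/-- Taking means, $\mathbb E\lambda^{n+1}_t=\mu+\int_0^t\Phi(t-s)\,\mathbb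
E\lambda^n_s\,ds\le\mu+c\int\Phi$, so any `c` satisfying `hc` is preserved by the iteration. -/
theorem IsPoissonLaw.lintegral_picard_le (hP : IsPoissonLaw P (intensityMeasure ν))
    (hΦ : Measurable Φ) {c : ℝ≥0∞} (hc : μ + c * ∫⁻ u, (Φ u : ℝ≥0∞) ∂lebesgue ≤ c)
    (n : ℕ) (t : ℝ≥0) : ∫⁻ ω, picard μ Φ n ω t ∂P ≤ c := by
  induction n generalizing t with
  | zero =>
    simp only [picard, lintegral_const, measure_univ, mul_one]
    exact le_self_add.trans hc
  | succ n ih =>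
    have hg : Measurable fun q : ℝ≥0 × ℝ =>
        if 0 < q.1 ∧ q.1 < t then (Φ (t - q.1) : ℝ≥0∞) else 0 := by
      refine Measurable.ite ?_ (by fun_prop) measurable_const
      exact (measurableSet_lt (by fun_prop) (by fun_prop)).inter
        (measurableSet_lt (by fun_prop) (by fun_prop))
    have h1 := hP.lintegral_thinned (measurable_picard μ hΦ n)
      (fun p ω => picard_shift μ Φ n ω le_rfl) hg
    simp only [picard]
    rw [lintegral_add_left measurable_const, lintegral_const, measure_univ, mul_one]
    refine le_trans (add_le_add le_rfl ?_) hc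
    refine le_trans (le_of_eq ?_) (h1.le.trans ?_)
    · refine lintegral_congr fun ω => lintegral_congr fun p => ?_
      rw [← ite_and]
      exact if_congr (by tauto) rfl rfl
    · refine (lintegral_mono fun q : ℝ≥0 × ℝ => mul_le_mul_right (ih q.1) _).trans ?_
      rw [lintegral_mul_const _ hg, mul_comm]
      refine mul_le_mul_right ?_ c
      rw [measurePreserving_fst.lintegral_comp (f := fun s : ℝ≥0 =>
        if 0 < s ∧ s < t then (Φ (t - s) : ℝ≥0∞) else 0)
        (hg.comp (measurable_prodMk_right (y := (0 : ℝ))))]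
      refine le_trans ?_ (setLIntegral_Iio_comp_sub_le (fun u => (Φ u : ℝ≥0∞)) t)
      rw [← lintegral_indicator measurableSet_Iio]
      refine lintegral_mono fun s => ?_
      dsimp only
      split_ifs with h
      · rw [Set.indicator_of_mem (Set.mem_Iio.2 h.2)]
      · exact zero_le

theorem IsPoissonLaw.exists_lintegral_hawkesIntensity_le
    (hP : IsPoissonLaw P (intensityMeasure ν)) (hΦ : Measurable Φ)
    (hΦ_lt : ∫⁻ u, (Φ u : ℝ≥0∞) ∂lebesgue < 1) :
    ∃ c : ℝ≥0, ∀ t, ∫⁻ ω, hawkesIntensity μ Φ ω t ∂P ≤ c := by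
  set φ := ∫⁻ u, (Φ u : ℝ≥0∞) ∂lebesgue with hφ
  have h0 : 1 - φ ≠ 0 := (tsub_pos_of_lt hΦ_lt).ne'
  -- The bound $\mu/(1-\varphi)$ is the fixed point of $c\mapsto\mu+c\varphi$.
  have hc : (μ : ℝ≥0∞) + μ * (1 - φ)⁻¹ * φ ≤ μ * (1 - φ)⁻¹ := by
    have h1 : (1 - φ)⁻¹ * (1 - φ) = 1 := ENNReal.inv_mul_cancel h0 (by finiteness)
    have h2 : (1 - φ) + φ = 1 := tsub_add_cancel_of_le hΦ_lt.le
    calc (μ : ℝ≥0∞) + μ * (1 - φ)⁻¹ * φ = μ * ((1 - φ)⁻¹ * (1 - φ)) + μ * (1 - φ)⁻¹ * φ := by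
          rw [h1, mul_one]
      _ = μ * (1 - φ)⁻¹ * ((1 - φ) + φ) := by ring
      _ ≤ _ := by rw [h2, mul_one]
  have hfin : (μ : ℝ≥0∞) * (1 - φ)⁻¹ ≠ ∞ :=
    ENNReal.mul_ne_top ENNReal.coe_ne_top (ENNReal.inv_ne_top.2 h0)
  refine ⟨(μ * (1 - φ)⁻¹ : ℝ≥0∞).toNNReal, fun t => ?_⟩
  rw [ENNReal.coe_toNNReal hfin]
  simp only [hawkesIntensity]
  rw [lintegral_iSup]
  · exact iSup_le fun n => hP.lintegral_picard_le hΦ hc n t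
  · exact fun n => (measurable_picard μ hΦ n).comp (f := fun ω => (ω, t)) (by fun_prop)
  · exact fun a b hab ω => picard_mono μ Φ ω t hab

/-- The Hawkes process does not explode. -/
theorem IsPoissonLaw.ae_hawkesCount_lt_top
    (hP : IsPoissonLaw P (intensityMeasure ν)) (hΦ : Measurable Φ)
    (hΦ_lt : ∫⁻ u, (Φ u : ℝ≥0∞) ∂lebesgue < 1) :
    ∀ᵐ ω ∂P, ∀ t, hawkesCount μ Φ t ω < ∞ := by
  obtain ⟨c, hc⟩ := hP.exists_lintegral_hawkesIntensity_le (μ := μ) hΦ hΦ_lt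
  -- At integer times the mean of the count is at most $nc$; since the count increases in `t`, one
  -- null set serves all times.
  have hnat : ∀ n : ℕ, ∀ᵐ ω ∂P, hawkesCount μ Φ (n : ℝ≥0) ω < ∞ := by
    intro n
    have hg : Measurable fun q : ℝ≥0 × ℝ => if 0 < q.1 ∧ q.1 ≤ (n : ℝ≥0) then (1 : ℝ≥0∞) else 0 := by
      refine Measurable.ite ?_ measurable_const measurable_const
      exact (measurableSet_lt (by fun_prop) (by fun_prop)).inter
        (measurableSet_le (by fun_prop) (by fun_prop))
    have h1 := hP.lintegral_thinned (measurable_hawkesIntensity μ hΦ)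
      (fun p ω => hawkesIntensity_shift μ Φ ω le_rfl) hg
    have h2 : ∀ ω, ∫⁻ p, (if (p.2.1 : ℝ≥0∞) ≤ hawkesIntensity μ Φ ω p.1 then
        (if 0 < p.1 ∧ p.1 ≤ (n : ℝ≥0) then (1 : ℝ≥0∞) else 0) else 0) ∂ω.toMeasure =
        hawkesCount μ Φ (n : ℝ≥0) ω := by
      intro ω
      refine lintegral_congr fun p => ?_
      rw [← ite_and]
      exact if_congr (by tauto) rfl rfl
    simp only [h2] at h1
    have h3 : ∫⁻ ω, hawkesCount μ Φ (n : ℝ≥0) ω ∂P < ∞ := by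
      rw [h1]
      refine (lintegral_mono fun q : ℝ≥0 × ℝ => mul_le_mul_right (hc q.1) _).trans_lt ?_
      rw [lintegral_mul_const _ hg, measurePreserving_fst.lintegral_comp (f := fun s : ℝ≥0 =>
        if 0 < s ∧ s ≤ (n : ℝ≥0) then (1 : ℝ≥0∞) else 0)
        (hg.comp (measurable_prodMk_right (y := (0 : ℝ))))]
      refine ENNReal.mul_lt_top (lt_of_le_of_lt (b := lebesgue (Set.Iic (n : ℝ≥0))) ?_ ?_)
        ENNReal.coe_lt_top
      · rw [← lintegral_indicator_one measurableSet_Iic]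
        refine lintegral_mono fun s => ?_
        dsimp only
        split_ifs with h
        · rw [Set.indicator_of_mem (Set.mem_Iic.2 h.2)]
          exact le_rfl
        · exact zero_le
      · rw [lebesgue_Iic]
        exact ENNReal.coe_lt_top
    have hmeas : Measurable fun ω => hawkesCount μ Φ (n : ℝ≥0) ω := by
      simp only [← h2]
      refine Measurable.lintegral_kernel_prod_right (κ := countingKernel)
        (f := fun (ω : Config) (p : Mark) => if (p.2.1 : ℝ≥0∞) ≤ hawkesIntensity μ Φ ω p.1 then
          (if 0 < p.1 ∧ p.1 ≤ (n : ℝ≥0) then (1 : ℝ≥0∞) else 0) else 0) ?_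
      refine Measurable.ite (measurableSet_le (f := fun q : Config × Mark => (q.2.2.1 : ℝ≥0∞))
        (by fun_prop) ?_) ?_ measurable_const
      · exact (measurable_hawkesIntensity μ hΦ).comp (f := fun q : Config × Mark => (q.1, q.2.1))
          (by fun_prop)
      · exact hg.comp (f := fun q : Config × Mark => (q.2.1, q.2.2.2)) (by fun_prop)
    exact ae_lt_top hmeas h3.ne
  filter_upwards [ae_all_iff.2 hnat] with ω hω t
  obtain ⟨n, hn⟩ := exists_nat_ge t
  refine lt_of_le_of_lt (lintegral_mono fun p => ?_) (hω n)
  dsimp only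
  split_ifs with h1 h2
  · exact le_rfl
  · exact absurd ⟨h1.1, h1.2.1.trans hn, h1.2.2⟩ h2
  · exact zero_le
  · exact le_rfl

theorem IsPoissonLaw.ae_exists_hawkesIntensity_eq_picard
    (hP : IsPoissonLaw P (intensityMeasure ν)) (hΦ : Measurable Φ)
    (hΦ_lt : ∫⁻ u, (Φ u : ℝ≥0∞) ∂lebesgue < 1) :
    ∀ᵐ ω ∂P, ∀ t, ∃ n, hawkesIntensity μ Φ ω t = picard μ Φ n ω t ∧ hawkesIntensity μ Φ ω t < ∞ := by
  filter_upwards [hP.ae_hawkesCount_lt_top (μ := μ) hΦ hΦ_lt] with ω hω t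
  exact exists_hawkesIntensity_eq_picard (hω t)

end Moment

/-- Almost surely at almost every time, all accepted points have the same effect on a functional
of `X`. -/
theorem IsPoissonLaw.ae_malliavin_eq {ν : Measure ℝ} [IsProbabilityMeasure ν] {P : Measure Config}
    [IsProbabilityMeasure P] (hP : IsPoissonLaw P (intensityMeasure ν)) {μ : ℝ≥0}
    {Φ : ℝ≥0 → ℝ≥0} (hΦ : Measurable Φ) (hΦ_lt : ∫⁻ u, (Φ u : ℝ≥0∞) ∂lebesgue < 1)
    {F : Config → ℝ} (hF : Measurable[sigmaX μ hΦ] F) :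
    ∀ᵐ ω ∂P, ∀ᵐ t ∂lebesgue, ∀ x : ℝ, ∀ θ : ℝ≥0, (θ : ℝ≥0∞) ≤ hawkesIntensity μ Φ ω t →
      malliavin F (t, θ, x) ω = malliavinHawkes μ Φ F t x ω := by
  filter_upwards [hP.ae_exists_hawkesIntensity_eq_picard (μ := μ) hΦ hΦ_lt] with ω hω
  have hcount : (Prod.fst '' ω.points).Countable := ω.countable.image _
  -- Off the countable set of times of points of `ω`, neither added point is already present.
  filter_upwards [hcount.ae_notMem lebesgue] with t ht x θ hθ
  obtain ⟨n, hn, hfin⟩ := hω t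
  have hnot : ∀ θ' : ℝ≥0, (t, θ', x) ∉ ω.points := fun θ' h => ht ⟨_, h, rfl⟩
  rw [malliavinHawkes, malliavin, malliavin]
  congr 1
  refine eq_of_measurable_sigmaX hΦ hF fun s => ?_
  -- Since $\lambda_t$ equals its `n`-th iterate, this iterate accepts both `θ` and the endpoint
  -- $\lambda_t$.
  refine compoundHawkes_shift_eq_shift (n₀ := n) (hn ▸ hθ) ?_ (hnot _) (hnot _) s
  rw [← hn, ENNReal.coe_toNNReal hfin.ne]


/-! ### Nonanticipating processes, boxes and $L^2$ estimates -/

/-- Jointly measurable processes which are not affected by points at the present time or later. -/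
structure NonAnticipating (u : Mark → Config → ℝ) : Prop where
  measurable : Measurable fun q : Config × Mark => u q.2 q.1
  apply_shift : ∀ p q ω, p.1 ≤ q.1 → u p (shift q ω) = u p ω

/-- The box `[0, K] × [0, K] × ℝ`. -/
def box (K : ℝ≥0) : Set Mark := {p | p.1 ≤ K ∧ p.2.1 ≤ K}

theorem measurableSet_box (K : ℝ≥0) : MeasurableSet (box K) :=
  (measurableSet_le (by fun_prop) measurable_const).inter
    (measurableSet_le (by fun_prop) measurable_const)

theorem box_mono {K L : ℝ≥0} (h : K ≤ L) : box K ⊆ box L :=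
  fun _ hp => ⟨hp.1.trans h, hp.2.trans h⟩

theorem intensityMeasure_box_lt_top (ν : Measure ℝ) [IsProbabilityMeasure ν] (K : ℝ≥0) :
    intensityMeasure ν (box K) < ∞ := by
  have : box K = Set.Iic K ×ˢ (Set.Iic K ×ˢ Set.univ) := by
    ext p
    simp [box]
  rw [this, intensityMeasure, Measure.prod_prod, Measure.prod_prod, lebesgue_Iic]
  simp only [measure_univ, mul_one]
  finiteness

theorem toMeasure_box_lt_top (ω : Config) (K : ℝ≥0) : ω.toMeasure (box K) < ∞ := by
  rw [Config.toMeasure_eq, Measure.restrict_apply (measurableSet_box K), Set.inter_comm]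
  exact Measure.count_apply_lt_top.2 (ω.locallyFinite K K)

/-- Processes bounded by `K` and supported in the box of size `K`. -/
def BoxBounded (K : ℝ≥0) (v : Mark → Config → ℝ) : Prop :=
  ∀ p ω, ‖v p ω‖ₑ ≤ (box K).indicator (fun _ => (K : ℝ≥0∞)) p

theorem BoxBounded.enorm_le {K : ℝ≥0} {v : Mark → Config → ℝ} (hv : BoxBounded K v) (p : Mark)
    (ω : Config) : ‖v p ω‖ₑ ≤ K :=
  (hv p ω).trans (Set.indicator_le_self' (fun _ _ => zero_le) p)

theorem BoxBounded.lintegral_le {K : ℝ≥0} {v : Mark → Config → ℝ} (hv : BoxBounded K v)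
    (ρ : Measure Mark) (ω : Config) : ∫⁻ p, ‖v p ω‖ₑ ∂ρ ≤ K * ρ (box K) := by
  rw [← lintegral_indicator_const (measurableSet_box K)]
  exact lintegral_mono fun p => hv p ω

theorem lintegral_mul_le_sqrt_mul_sqrt {α : Type*} [MeasurableSpace α] (ρ : Measure α)
    {f g : α → ℝ≥0∞} (hf : AEMeasurable f ρ) (hg : AEMeasurable g ρ) :
    ∫⁻ a, f a * g a ∂ρ ≤
      (∫⁻ a, f a ^ 2 ∂ρ) ^ (1 / 2 : ℝ) * (∫⁻ a, g a ^ 2 ∂ρ) ^ (1 / 2 : ℝ) := by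
  have := ENNReal.lintegral_mul_le_Lp_mul_Lq ρ Real.HolderConjugate.two_two hf hg
  simpa only [Pi.mul_apply, ENNReal.rpow_two] using this

theorem lintegral_mul_lt_top_of_sq {α : Type*} [MeasurableSpace α] {ρ : Measure α}
    {f g : α → ℝ≥0∞} (hf : AEMeasurable f ρ) (hg : AEMeasurable g ρ)
    (hf2 : ∫⁻ a, f a ^ 2 ∂ρ < ∞) (hg2 : ∫⁻ a, g a ^ 2 ∂ρ < ∞) : ∫⁻ a, f a * g a ∂ρ < ∞ :=
  (lintegral_mul_le_sqrt_mul_sqrt ρ hf hg).trans_lt <| ENNReal.mul_lt_top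
    (ENNReal.rpow_lt_top_of_nonneg (by norm_num) hf2.ne)
    (ENNReal.rpow_lt_top_of_nonneg (by norm_num) hg2.ne)

theorem lintegral_add_sq_lt_top {α : Type*} [MeasurableSpace α] {ρ : Measure α}
    {f g : α → ℝ≥0∞} (hf : AEMeasurable f ρ)
    (hf2 : ∫⁻ a, f a ^ 2 ∂ρ < ∞) (hg2 : ∫⁻ a, g a ^ 2 ∂ρ < ∞) :
    ∫⁻ a, (f a + g a) ^ 2 ∂ρ < ∞ := by
  have h : ∀ a b : ℝ≥0∞, (a + b) ^ 2 ≤ 2 * a ^ 2 + 2 * b ^ 2 := by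
    intro a b
    have := ENNReal.rpow_add_le_mul_rpow_add_rpow a b (p := 2) (by norm_num)
    norm_num at this
    rw [← mul_add]
    exact this
  refine (lintegral_mono fun a => h (f a) (g a)).trans_lt ?_
  rw [lintegral_add_left' ((hf.pow_const 2).const_mul 2), lintegral_const_mul' _ _ (by simp),
    lintegral_const_mul' _ _ (by simp)]
  finiteness

theorem memLp_two_iff_lintegral {α : Type*} [MeasurableSpace α] {ρ : Measure α} {f : α → ℝ}
    (hf : AEStronglyMeasurable f ρ) : MemLp f 2 ρ ↔ ∫⁻ a, ‖f a‖ₑ ^ 2 ∂ρ < ∞ := by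
  rw [MemLp, and_iff_right hf, eLpNorm_lt_top_iff_lintegral_rpow_enorm_lt_top (by simp) (by simp)]
  simp

/-! ### Measurability of integrals against the random measure -/

section Measurability

variable {u : Mark → Config → ℝ}

theorem stronglyMeasurable_integral_toMeasure (hu : Measurable fun q : Config × Mark => u q.2 q.1) :
    StronglyMeasurable fun ω => ∫ p, u p ω ∂ω.toMeasure :=
  StronglyMeasurable.integral_kernel_prod_right' (κ := countingKernel)
    (f := fun q : Config × Mark => u q.2 q.1) hu.stronglyMeasurable

theorem stronglyMeasurable_integral_intensityMeasure (ν : Measure ℝ) [IsProbabilityMeasure ν]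
    (hu : Measurable fun q : Config × Mark => u q.2 q.1) :
    StronglyMeasurable fun ω => ∫ p, u p ω ∂intensityMeasure ν :=
  StronglyMeasurable.integral_prod_right' (f := fun q : Config × Mark => u q.2 q.1)
    hu.stronglyMeasurable

theorem stronglyMeasurable_divergence (ν : Measure ℝ) [IsProbabilityMeasure ν]
    (hu : Measurable fun q : Config × Mark => u q.2 q.1) :
    StronglyMeasurable (divergence ν u) :=
  (stronglyMeasurable_integral_toMeasure hu).sub (stronglyMeasurable_integral_intensityMeasure ν hu)

theorem measurable_lintegral_toMeasure {f : Config × Mark → ℝ≥0∞} (hf : Measurable f) :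
    Measurable fun ω : Config => ∫⁻ p, f (ω, p) ∂ω.toMeasure :=
  Measurable.lintegral_kernel_prod_right' (κ := countingKernel) hf

theorem measurable_apply_config (hu : Measurable fun q : Config × Mark => u q.2 q.1) (ω : Config) :
    Measurable fun p => u p ω := hu.comp (f := fun p => (ω, p)) measurable_prodMk_left

theorem measurable_apply_mark (hu : Measurable fun q : Config × Mark => u q.2 q.1) (p : Mark) :
    Measurable (u p) := hu.comp (f := fun ω => (ω, p)) measurable_prodMk_right

theorem measurable_malliavin {F : Config → ℝ} (hF : Measurable F) :
    Measurable fun q : Config × Mark => malliavin F q.2 q.1 :=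
  (hF.comp measurable_shift).sub (hF.comp measurable_fst)

theorem BoxBounded.integrable {K : ℝ≥0} (hv : BoxBounded K u)
    (hu : Measurable fun q : Config × Mark => u q.2 q.1) {ρ : Measure Mark} (hρ : ρ (box K) < ∞)
    (ω : Config) : Integrable (fun p => u p ω) ρ :=
  ⟨(measurable_apply_config hu ω).aestronglyMeasurable,
    (hv.lintegral_le ρ ω).trans_lt (by finiteness)⟩

theorem enorm_divergence_le (ν : Measure ℝ) (u : Mark → Config → ℝ) (ω : Config) :
    ‖divergence ν u ω‖ₑ ≤ ∫⁻ p, ‖u p ω‖ₑ ∂ω.toMeasure + ∫⁻ p, ‖u p ω‖ₑ ∂intensityMeasure ν :=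
  enorm_sub_le.trans (add_le_add (enorm_integral_le_lintegral_enorm _)
    (enorm_integral_le_lintegral_enorm _))

theorem divergence_sub {ν : Measure ℝ} {u v : Mark → Config → ℝ} {ω : Config}
    (hu : Integrable (fun p => u p ω) ω.toMeasure)
    (hu' : Integrable (fun p => u p ω) (intensityMeasure ν))
    (hv : Integrable (fun p => v p ω) ω.toMeasure)
    (hv' : Integrable (fun p => v p ω) (intensityMeasure ν)) :
    divergence ν (fun p ω => u p ω - v p ω) ω = divergence ν u ω - divergence ν v ω := by
  rw [divergence, divergence, divergence, integral_sub hu hv, integral_sub hu' hv']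
  ring

end Measurability

/-! ### Integration by parts for bounded integrands -/

section Bounded

variable {ν : Measure ℝ} [IsProbabilityMeasure ν] {P : Measure Config} [IsProbabilityMeasure P]
  {v : Mark → Config → ℝ} {K : ℝ≥0}

/-- Mecke applied to $\mathbf 1_B(p)\,N(B)$ gives $\mathbb E N(B)^2\le m(B)(\mathbb E N(B)+1)$. -/
theorem IsPoissonLaw.lintegral_toMeasure_sq_lt_top (hP : IsPoissonLaw P (intensityMeasure ν))
    {B : Set Mark} (hB : MeasurableSet B) (hmB : intensityMeasure ν B < ∞) :
    ∫⁻ ω, ω.toMeasure B ^ 2 ∂P < ∞ := by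
  have h1 : ∫⁻ ω, ω.toMeasure B ∂P = intensityMeasure ν B := by
    have := hP.lintegral_mecke (u := fun q : Config × Mark => B.indicator 1 q.2)
      ((measurable_one.indicator hB).comp measurable_snd)
    simpa [lintegral_indicator_one hB] using this
  have h2 := hP.lintegral_mecke (u := fun q : Config × Mark =>
    B.indicator 1 q.2 * q.1.toMeasure B) (((measurable_one.indicator hB).comp measurable_snd).mul
      ((measurable_toMeasure_apply hB).comp measurable_fst))
  have h3 : ∀ ω : Config, ∫⁻ p, B.indicator 1 p * ω.toMeasure B ∂ω.toMeasure = ω.toMeasure B ^ 2 := by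
    intro ω
    rw [lintegral_mul_const _ (measurable_one.indicator hB), lintegral_indicator_one hB, sq]
  simp only [h3] at h2
  rw [h2]
  have h4 : ∀ ω : Config, ∫⁻ p, B.indicator 1 p * (shift p ω).toMeasure B ∂intensityMeasure ν ≤
      intensityMeasure ν B * (ω.toMeasure B + 1) := by
    intro ω
    rw [← lintegral_indicator_one hB, ← lintegral_mul_const _ (measurable_one.indicator hB)]
    refine lintegral_mono fun p => mul_le_mul_right ?_ _
    rw [shift_apply _ _ hB]
    exact add_le_add (measure_mono Set.sdiff_subset) (Set.indicator_le_self' (fun _ _ => zero_le) p)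
  refine (lintegral_mono h4).trans_lt ?_
  rw [lintegral_const_mul _ ((measurable_toMeasure_apply hB).add_const 1),
    lintegral_add_right _ measurable_const, h1]
  simp only [lintegral_const, measure_univ, mul_one]
  finiteness

theorem BoxBounded.memLp_divergence (hv : BoxBounded K v)
    (hP : IsPoissonLaw P (intensityMeasure ν))
    (hvm : Measurable fun q : Config × Mark => v q.2 q.1) : MemLp (divergence ν v) 2 P := by
  rw [memLp_two_iff_lintegral (stronglyMeasurable_divergence ν hvm).aestronglyMeasurable]
  have hb := intensityMeasure_box_lt_top ν K
  refine (lintegral_mono fun ω => pow_le_pow_left' ((enorm_divergence_le ν v ω).trans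
    (add_le_add (hv.lintegral_le _ ω) (hv.lintegral_le _ ω))) 2).trans_lt ?_
  refine lintegral_add_sq_lt_top
    ((measurable_toMeasure_apply (measurableSet_box K)).const_mul _).aemeasurable ?_ ?_
  · simp only [mul_pow]
    rw [lintegral_const_mul' _ _ (by finiteness)]
    exact ENNReal.mul_lt_top (by finiteness)
      (hP.lintegral_toMeasure_sq_lt_top (measurableSet_box K) hb)
  · simp only [lintegral_const, measure_univ, mul_one]
    finiteness

/-- The integration by parts formula for bounded integrands. -/
theorem BoxBounded.integral_mul_divergence (hv : BoxBounded K v)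
    (hP : IsPoissonLaw P (intensityMeasure ν)) (hvn : NonAnticipating v) {G : Config → ℝ}
    (hG : Measurable G) (hG2 : MemLp G 2 P) :
    Integrable (fun q : Config × Mark => v q.2 q.1 * malliavin G q.2 q.1)
      (P.prod (intensityMeasure ν)) ∧
    ∫ ω, G ω * divergence ν v ω ∂P =
      ∫ q : Config × Mark, v q.2 q.1 * malliavin G q.2 q.1 ∂P.prod (intensityMeasure ν) := by
  have hvm := hvn.measurable
  have hb := intensityMeasure_box_lt_top ν K
  have hGv : Measurable fun q : Config × Mark => G q.1 * v q.2 q.1 :=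
    (hG.comp measurable_fst).mul hvm
  have hG2' := (memLp_two_iff_lintegral hG2.1).1 hG2
  have hbound : ∀ κ : Config → Measure Mark, ∀ ω, ∫⁻ p, ‖G ω * v p ω‖ₑ ∂κ ω ≤
      ‖G ω‖ₑ * (K * κ ω (box K)) := by
    intro κ ω
    simp only [enorm_mul]
    rw [lintegral_const_mul' _ _ (by finiteness)]
    exact mul_le_mul_right (hv.lintegral_le _ ω) _
  have hiN : Integrable (fun q : Config × Mark => G q.1 * v q.2 q.1) (P ⊗ₘ countingKernel) := by
    refine ⟨hGv.aestronglyMeasurable, ?_⟩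
    rw [HasFiniteIntegral, Measure.lintegral_compProd hGv.enorm]
    refine (lintegral_mono fun ω => hbound Config.toMeasure ω).trans_lt ?_
    refine lintegral_mul_lt_top_of_sq hG.enorm.aemeasurable
      ((measurable_toMeasure_apply (measurableSet_box K)).const_mul _).aemeasurable hG2' ?_
    simp only [mul_pow]
    rw [lintegral_const_mul' _ _ (by finiteness)]
    exact ENNReal.mul_lt_top (by finiteness)
      (hP.lintegral_toMeasure_sq_lt_top (measurableSet_box K) hb)
  have him : Integrable (fun q : Config × Mark => G q.1 * v q.2 q.1)
      (P.prod (intensityMeasure ν)) := by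
    refine ⟨hGv.aestronglyMeasurable, ?_⟩
    rw [HasFiniteIntegral, lintegral_prod _ hGv.enorm.aemeasurable]
    refine (lintegral_mono fun ω => hbound (fun _ => intensityMeasure ν) ω).trans_lt ?_
    refine lintegral_mul_lt_top_of_sq hG.enorm.aemeasurable aemeasurable_const hG2' ?_
    simp only [lintegral_const, measure_univ, mul_one]
    finiteness
  have his := (hP.integrable_mecke hGv).1 hiN
  -- As $v_p=v_p\circ\varepsilon_p^+$, the product $v_pD_pG$ is the difference of $Gv_p$ after and
  -- before adding `p`; Mecke turns the first term into an integral against `N`.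
  have heq : ∀ q : Config × Mark, v q.2 q.1 * malliavin G q.2 q.1 =
      G (shift q.2 q.1) * v q.2 (shift q.2 q.1) - G q.1 * v q.2 q.1 := by
    intro q
    rw [hvn.apply_shift _ _ _ le_rfl, malliavin]
    ring
  simp only [heq]
  refine ⟨his.sub him, ?_⟩
  rw [integral_sub his him, ← hP.integral_mecke hGv his, integral_prod _ him, ← integral_sub]
  · refine integral_congr_ae (Filter.Eventually.of_forall fun ω => ?_)
    simp only [integral_const_mul]
    rw [divergence, mul_sub]
  · exact hiN.integral_compProd
  · exact him.integral_prod_left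

theorem BoxBounded.integral_divergence_eq_zero (hv : BoxBounded K v)
    (hP : IsPoissonLaw P (intensityMeasure ν)) (hvn : NonAnticipating v) :
    ∫ ω, divergence ν v ω ∂P = 0 := by
  have := (hv.integral_mul_divergence hP hvn (G := fun _ => 1) measurable_const
    (memLp_const 1)).2
  simpa [malliavin] using this

end Bounded


/-! ### The isometry of the divergence -/

section Isometry

variable {ν : Measure ℝ} [IsProbabilityMeasure ν] {P : Measure Config} [IsProbabilityMeasure P]
  {v : Mark → Config → ℝ} {K : ℝ≥0}

theorem measurable_comp_shift (hvm : Measurable fun q : Config × Mark => v q.2 q.1) (p : Mark) :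
    Measurable fun q : Config × Mark => v q.2 (shift p q.1) :=
  hvm.comp (f := fun q : Config × Mark => (shift p q.1, q.2))
    ((measurable_shift.comp (f := fun q : Config × Mark => (q.1, p)) (by fun_prop)).prodMk
      measurable_snd)

/-- The commutation relation between the Malliavin derivative and the divergence. -/
theorem BoxBounded.malliavin_divergence (hv : BoxBounded K v) (hvn : NonAnticipating v) {p : Mark}
    {ω : Config} (hp : p ∉ ω.points) :
    malliavin (divergence ν v) p ω =
      v p ω + divergence ν (fun q ω => v q (shift p ω) - v q ω) ω := by
  have hvs : BoxBounded K fun q ω => v q (shift p ω) := fun q ω => hv q _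
  have hvsm := measurable_comp_shift hvn.measurable p
  have hN := toMeasure_box_lt_top ω K
  have hb := intensityMeasure_box_lt_top ν K
  rw [divergence_sub (u := fun q ω => v q (shift p ω)) (hvs.integrable hvsm hN ω) (hvs.integrable hvsm hb ω)
    (hv.integrable hvn.measurable hN ω) (hv.integrable hvn.measurable hb ω)]
  rw [malliavin, divergence, integral_shift_of_notMem hp, if_pos (hvs.integrable hvsm hN ω),
    hvn.apply_shift _ _ _ le_rfl]
  simp only [divergence]
  ring

/-- With `p` fixed, $v_p$ can be moved under the divergence. The process $q\mapsto v_pD_pv_q$ is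
nonanticipating: it vanishes if `q` is not later than `p`, and otherwise $v_p$ is already determined
before `q`. Its divergence therefore has mean zero. -/
theorem BoxBounded.integral_mul_divergence_sub_eq_zero (hv : BoxBounded K v)
    (hP : IsPoissonLaw P (intensityMeasure ν)) (hvn : NonAnticipating v) (p : Mark) :
    ∫ ω, v p ω * divergence ν (fun q ω => v q (shift p ω) - v q ω) ω ∂P = 0 := by
  have hvsm := measurable_comp_shift hvn.measurable p
  have hyn : NonAnticipating fun q ω => v p ω * (v q (shift p ω) - v q ω) := by
    refine ⟨((measurable_apply_mark hvn.measurable p).comp measurable_fst).mul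
      (hvsm.sub hvn.measurable), fun q r ω hqr => ?_⟩
    rw [shift_comm, hvn.apply_shift q r _ hqr, hvn.apply_shift q r _ hqr]
    rcases le_total q.1 p.1 with h | h
    · rw [hvn.apply_shift q p _ h]
      simp
    · rw [hvn.apply_shift p r _ (h.trans hqr)]
  -- The values are bounded by $K(K+K)$; the maximum with `K` keeps the support inside the box.
  have hyb : BoxBounded (max K (2 * K * K)) fun q ω => v p ω * (v q (shift p ω) - v q ω) := by
    intro q ω
    by_cases hq : q ∈ box K
    · rw [Set.indicator_of_mem (box_mono (le_max_left _ _) hq), enorm_mul]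
      calc ‖v p ω‖ₑ * ‖v q (shift p ω) - v q ω‖ₑ ≤ K * (K + K) := mul_le_mul' (hv.enorm_le _ _)
            (enorm_sub_le.trans (add_le_add (hv.enorm_le _ _) (hv.enorm_le _ _)))
        _ = ((2 * K * K : ℝ≥0) : ℝ≥0∞) := by push_cast; ring
        _ ≤ _ := by exact_mod_cast le_max_right _ _
    · have h0 : ∀ ω, v q ω = 0 := fun ω => by
        have := hv q ω
        rwa [Set.indicator_of_notMem hq, nonpos_iff_eq_zero, enorm_eq_zero] at this
      simp [h0]
  have := hyb.integral_divergence_eq_zero hP hyn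
  rw [← this]
  refine integral_congr_ae (Filter.Eventually.of_forall fun ω => ?_)
  simp only [divergence, integral_const_mul]
  ring

/-- The isometry property of the divergence, for bounded integrands. -/
theorem BoxBounded.lintegral_divergence_sq (hv : BoxBounded K v)
    (hP : IsPoissonLaw P (intensityMeasure ν)) (hvn : NonAnticipating v) :
    ∫⁻ ω, ‖divergence ν v ω‖ₑ ^ 2 ∂P =
      ∫⁻ q : Config × Mark, ‖v q.2 q.1‖ₑ ^ 2 ∂P.prod (intensityMeasure ν) := by
  have hvm := hvn.measurable
  have hδ := hv.memLp_divergence hP hvm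
  have hδm := (stronglyMeasurable_divergence ν hvm).measurable
  -- The divergence itself is the test variable: its second moment becomes $\mathbb E\int
  -- v_pD_p\delta^N(v)\,dm$, to which the commutation relation applies for each `p`.
  obtain ⟨hi, heq⟩ := hv.integral_mul_divergence hP hvn hδm hδ
  have hv2 : Integrable (fun q : Config × Mark => v q.2 q.1 * v q.2 q.1)
      (P.prod (intensityMeasure ν)) := by
    refine ⟨(hvm.mul hvm).aestronglyMeasurable, ?_⟩
    rw [HasFiniteIntegral, lintegral_prod _ (hvm.fun_mul hvm).enorm.aemeasurable]
    have hb := intensityMeasure_box_lt_top ν K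
    calc ∫⁻ ω, ∫⁻ p, ‖v p ω * v p ω‖ₑ ∂intensityMeasure ν ∂P
        ≤ ∫⁻ _, K * (K * intensityMeasure ν (box K)) ∂P := by
          refine lintegral_mono fun ω => ?_
          refine le_trans (lintegral_mono fun p => ?_)
            ((lintegral_const_mul' (K : ℝ≥0∞) (fun p => ‖v p ω‖ₑ) (by finiteness)).le.trans
              (mul_le_mul_right (hv.lintegral_le _ ω) _))
          rw [enorm_mul]
          exact mul_le_mul_left (hv.enorm_le _ _) _
      _ < ∞ := by
          simp only [lintegral_const, measure_univ, mul_one]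
          finiteness
  have hδ2 : Integrable (fun ω => divergence ν v ω * divergence ν v ω) P := hδ.integrable_mul hδ
  have hmain : ∫ ω, divergence ν v ω * divergence ν v ω ∂P =
      ∫ q : Config × Mark, v q.2 q.1 * v q.2 q.1 ∂P.prod (intensityMeasure ν) := by
    rw [heq, integral_prod_symm _ hi, integral_prod_symm _ hv2]
    refine integral_congr_ae (Filter.Eventually.of_forall fun p => ?_)
    dsimp only
    have hws : BoxBounded (2 * K) fun q ω => v q (shift p ω) - v q ω := by
      intro q ω
      refine enorm_sub_le.trans ((add_le_add (hv q _) (hv q ω)).trans ?_)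
      by_cases hq : q ∈ box K
      · rw [Set.indicator_of_mem hq, Set.indicator_of_mem (box_mono (le_mul_of_one_le_left'
          one_le_two) hq)]
        push_cast
        rw [two_mul]
      · simp [Set.indicator_of_notMem hq]
    have hwm : Measurable fun q : Config × Mark => v q.2 (shift p q.1) - v q.2 q.1 :=
      (measurable_comp_shift hvm p).sub hvm
    have hvp : MemLp (v p) 2 P := by
      rw [memLp_two_iff_lintegral (measurable_apply_mark hvm p).aestronglyMeasurable]
      refine (lintegral_mono fun ω => pow_le_pow_left' (hv.enorm_le p ω) 2).trans_lt ?_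
      simp only [lintegral_const, measure_univ, mul_one]
      finiteness
    have h1 : ∫ ω, v p ω * malliavin (divergence ν v) p ω ∂P = ∫ ω, (v p ω * v p ω +
        v p ω * divergence ν (fun q ω => v q (shift p ω) - v q ω) ω) ∂P := by
      refine integral_congr_ae ?_
      filter_upwards [hP.ae_notMem p] with ω hω
      rw [hv.malliavin_divergence hvn hω, mul_add]
    have h2 : Integrable (fun ω => v p ω * v p ω) P := hvp.integrable_mul hvp
    have h3 : Integrable (fun ω => v p ω *
        divergence ν (fun q ω => v q (shift p ω) - v q ω) ω) P :=
      hvp.integrable_mul (hws.memLp_divergence hP hwm)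
    rw [h1, integral_add h2 h3,
      hv.integral_mul_divergence_sub_eq_zero hP hvn p, add_zero]
  have hsq : ∀ x : ℝ, ‖x‖ₑ ^ 2 = ENNReal.ofReal (x * x) := fun x => by
    rw [← sq, ← sq_abs, ENNReal.ofReal_pow (abs_nonneg x), ← Real.norm_eq_abs, ofReal_norm]
  simp only [hsq]
  rw [← ofReal_integral_eq_lintegral_ofReal hδ2
      (Filter.Eventually.of_forall fun ω => mul_self_nonneg _),
    ← ofReal_integral_eq_lintegral_ofReal hv2
      (Filter.Eventually.of_forall fun q => mul_self_nonneg _)]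
  rw [hmain]

end Isometry

/-! ### Truncation -/

open Classical in
/-- The truncation of a process to a box. -/
noncomputable def truncate (n : ℕ) (u : Mark → Config → ℝ) (p : Mark) (ω : Config) : ℝ :=
  if p ∈ box n ∧ ‖u p ω‖ₑ ≤ n then u p ω else 0

section Truncate

variable {u : Mark → Config → ℝ}

/-- The cut-off depends only on `p` and on the value of `u` at `p`, so it adds no anticipation. -/
theorem NonAnticipating.truncate (hu : NonAnticipating u) (n : ℕ) :
    NonAnticipating (truncate n u) := by
  classical
  refine ⟨Measurable.ite ?_ hu.measurable measurable_const, fun p q ω h => ?_⟩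
  · exact (measurable_snd (measurableSet_box n)).inter
      (measurableSet_le hu.measurable.enorm measurable_const)
  · simp only [HawkesIBP.truncate, hu.apply_shift p q ω h]

theorem boxBounded_truncate (n : ℕ) (u : Mark → Config → ℝ) : BoxBounded n (truncate n u) := by
  intro p ω
  rw [truncate]
  split_ifs with h
  · rw [Set.indicator_of_mem h.1]
    exact h.2
  · simp

theorem enorm_truncate_le (n : ℕ) (u : Mark → Config → ℝ) (p : Mark) (ω : Config) :
    ‖truncate n u p ω‖ₑ ≤ ‖u p ω‖ₑ := by
  rw [truncate]
  split_ifs <;> simp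

theorem norm_truncate_le (n : ℕ) (u : Mark → Config → ℝ) (p : Mark) (ω : Config) :
    ‖truncate n u p ω‖ ≤ ‖u p ω‖ := by
  rw [truncate]
  split_ifs <;> simp

theorem enorm_truncate_sub_le (n : ℕ) (u : Mark → Config → ℝ) (p : Mark) (ω : Config) :
    ‖truncate n u p ω - u p ω‖ₑ ≤ ‖u p ω‖ₑ := by
  rw [truncate]
  split_ifs <;> simp

theorem eventually_truncate_eq (u : Mark → Config → ℝ) (p : Mark) (ω : Config) :
    ∀ᶠ n in Filter.atTop, truncate n u p ω = u p ω := by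
  obtain ⟨n₀, hn₀⟩ := exists_nat_ge (max (max p.1 p.2.1) ‖u p ω‖₊)
  filter_upwards [Filter.eventually_ge_atTop n₀] with n hn
  have hn' : max (max p.1 p.2.1) ‖u p ω‖₊ ≤ (n : ℝ≥0) := hn₀.trans (by exact_mod_cast hn)
  refine if_pos ⟨⟨?_, ?_⟩, ?_⟩
  · exact ((le_max_left _ _).trans (le_max_left _ _)).trans hn'
  · exact ((le_max_right _ _).trans (le_max_left _ _)).trans hn'
  · have : ‖u p ω‖₊ ≤ (n : ℝ≥0) := (le_max_right _ _).trans hn'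
    rw [enorm_eq_nnnorm]
    exact_mod_cast this

theorem tendsto_truncate (u : Mark → Config → ℝ) (p : Mark) (ω : Config) :
    Filter.Tendsto (fun n => truncate n u p ω) Filter.atTop (nhds (u p ω)) :=
  tendsto_const_nhds.congr' (Filter.EventuallyEq.symm (eventually_truncate_eq u p ω))

end Truncate

/-! ### The divergence of integrable nonanticipating processes -/

section Divergence

variable {ν : Measure ℝ} [IsProbabilityMeasure ν] {P : Measure Config} [IsProbabilityMeasure P]
  {u : Mark → Config → ℝ}

/-- By this equality of means, one integrability condition makes both parts of the divergence
converge absolutely almost surely. -/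
theorem NonAnticipating.lintegral_toMeasure (hu : NonAnticipating u)
    (hP : IsPoissonLaw P (intensityMeasure ν)) :
    ∫⁻ ω, ∫⁻ p, ‖u p ω‖ₑ ∂ω.toMeasure ∂P = ∫⁻ ω, ∫⁻ p, ‖u p ω‖ₑ ∂intensityMeasure ν ∂P := by
  rw [hP.lintegral_mecke (u := fun q : Config × Mark => ‖u q.2 q.1‖ₑ) hu.measurable.enorm]
  simp only [hu.apply_shift _ _ _ le_rfl]

theorem NonAnticipating.ae_integrable (hu : NonAnticipating u)
    (hP : IsPoissonLaw P (intensityMeasure ν))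
    (hi : ∫⁻ ω, ∫⁻ p, ‖u p ω‖ₑ ∂intensityMeasure ν ∂P < ∞) :
    ∀ᵐ ω ∂P, Integrable (fun p => u p ω) ω.toMeasure ∧
      Integrable (fun p => u p ω) (intensityMeasure ν) := by
  have h1 := ae_lt_top (measurable_lintegral_toMeasure hu.measurable.enorm)
    ((hu.lintegral_toMeasure hP).trans_lt hi).ne
  have h2 := ae_lt_top hu.measurable.enorm.lintegral_prod_right' hi.ne
  filter_upwards [h1, h2] with ω h1 h2
  exact ⟨⟨(measurable_apply_config hu.measurable ω).aestronglyMeasurable, h1⟩,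
    ⟨(measurable_apply_config hu.measurable ω).aestronglyMeasurable, h2⟩⟩

/-- Divergences of truncations converge pathwise by dominated convergence; Fatou and the bounded
isometry give the bound, which suffices for the extension. -/
theorem NonAnticipating.lintegral_divergence_sq_le (hu : NonAnticipating u)
    (hP : IsPoissonLaw P (intensityMeasure ν))
    (hi : ∫⁻ ω, ∫⁻ p, ‖u p ω‖ₑ ∂intensityMeasure ν ∂P < ∞) :
    ∫⁻ ω, ‖divergence ν u ω‖ₑ ^ 2 ∂P ≤
      ∫⁻ q : Config × Mark, ‖u q.2 q.1‖ₑ ^ 2 ∂P.prod (intensityMeasure ν) := by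
  have hlim : ∀ᵐ ω ∂P, Filter.Tendsto (fun n => ‖divergence ν (HawkesIBP.truncate n u) ω‖ₑ ^ 2)
      Filter.atTop (nhds (‖divergence ν u ω‖ₑ ^ 2)) := by
    filter_upwards [hu.ae_integrable hP hi] with ω hω
    refine ENNReal.Tendsto.pow ((Filter.Tendsto.sub ?_ ?_).enorm)
    · exact tendsto_integral_of_dominated_convergence (fun p => ‖u p ω‖)
        (fun n => (measurable_apply_config (hu.truncate n).measurable ω).aestronglyMeasurable)
        hω.1.norm (fun n => Filter.Eventually.of_forall fun p => norm_truncate_le n u p ω)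
        (Filter.Eventually.of_forall fun p => tendsto_truncate u p ω)
    · exact tendsto_integral_of_dominated_convergence (fun p => ‖u p ω‖)
        (fun n => (measurable_apply_config (hu.truncate n).measurable ω).aestronglyMeasurable)
        hω.2.norm (fun n => Filter.Eventually.of_forall fun p => norm_truncate_le n u p ω)
        (Filter.Eventually.of_forall fun p => tendsto_truncate u p ω)
  calc ∫⁻ ω, ‖divergence ν u ω‖ₑ ^ 2 ∂P
      = ∫⁻ ω, Filter.liminf (fun n => ‖divergence ν (HawkesIBP.truncate n u) ω‖ₑ ^ 2)
          Filter.atTop ∂P := lintegral_congr_ae (hlim.mono fun ω h => h.liminf_eq.symm)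
    _ ≤ Filter.liminf (fun n => ∫⁻ ω, ‖divergence ν (HawkesIBP.truncate n u) ω‖ₑ ^ 2 ∂P)
          Filter.atTop := lintegral_liminf_le fun n =>
        (stronglyMeasurable_divergence ν (hu.truncate n).measurable).measurable.enorm.pow_const 2
    _ ≤ Filter.liminf (fun _ : ℕ => ∫⁻ q : Config × Mark, ‖u q.2 q.1‖ₑ ^ 2
          ∂P.prod (intensityMeasure ν)) Filter.atTop := by
        refine Filter.liminf_le_liminf (Filter.Eventually.of_forall fun n => ?_)
        rw [(boxBounded_truncate n u).lintegral_divergence_sq hP (hu.truncate n)]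
        exact lintegral_mono fun q => pow_le_pow_left' (enorm_truncate_le n u _ _) 2
    _ = _ := Filter.liminf_const _

theorem NonAnticipating.memLp_divergence (hu : NonAnticipating u)
    (hP : IsPoissonLaw P (intensityMeasure ν))
    (hi : ∫⁻ ω, ∫⁻ p, ‖u p ω‖ₑ ∂intensityMeasure ν ∂P < ∞)
    (hi2 : ∫⁻ q : Config × Mark, ‖u q.2 q.1‖ₑ ^ 2 ∂P.prod (intensityMeasure ν) < ∞) :
    MemLp (divergence ν u) 2 P :=
  (memLp_two_iff_lintegral (stronglyMeasurable_divergence ν hu.measurable).aestronglyMeasurable).2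
    ((hu.lintegral_divergence_sq_le hP hi).trans_lt hi2)

/-- The integration by parts formula. -/
theorem NonAnticipating.integral_mul_divergence (hu : NonAnticipating u)
    (hP : IsPoissonLaw P (intensityMeasure ν))
    (hi : ∫⁻ ω, ∫⁻ p, ‖u p ω‖ₑ ∂intensityMeasure ν ∂P < ∞)
    (hi2 : ∫⁻ q : Config × Mark, ‖u q.2 q.1‖ₑ ^ 2 ∂P.prod (intensityMeasure ν) < ∞)
    {F : Config → ℝ} (hF : Measurable F) (hF2 : MemLp F 2 P)
    (hFi : Integrable (fun q : Config × Mark => u q.2 q.1 * malliavin F q.2 q.1)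
      (P.prod (intensityMeasure ν))) :
    ∫ ω, F ω * divergence ν u ω ∂P =
      ∫ q : Config × Mark, u q.2 q.1 * malliavin F q.2 q.1 ∂P.prod (intensityMeasure ν) := by
  have hδ := hu.memLp_divergence hP hi hi2
  have hδn : ∀ n, MemLp (divergence ν (HawkesIBP.truncate n u)) 2 P := fun n =>
    (boxBounded_truncate n u).memLp_divergence hP (hu.truncate n).measurable
  have hdm : ∀ n, Measurable fun q : Config × Mark => HawkesIBP.truncate n u q.2 q.1 - u q.2 q.1 :=
    fun n => (hu.truncate n).measurable.sub hu.measurable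
  have hdn : ∀ n, NonAnticipating fun p ω => HawkesIBP.truncate n u p ω - u p ω := fun n =>
    ⟨hdm n, fun p q ω h => by rw [(hu.truncate n).apply_shift p q ω h, hu.apply_shift p q ω h]⟩
  have hzero : Filter.Tendsto (fun n => ∫⁻ q : Config × Mark,
      ‖HawkesIBP.truncate n u q.2 q.1 - u q.2 q.1‖ₑ ^ 2 ∂P.prod (intensityMeasure ν))
      Filter.atTop (nhds 0) := by
    rw [← lintegral_zero (μ := P.prod (intensityMeasure ν)) (α := Config × Mark)]
    refine tendsto_lintegral_of_dominated_convergence (fun q => ‖u q.2 q.1‖ₑ ^ 2)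
      (fun n => (hdm n).enorm.pow_const 2)
      (fun n => Filter.Eventually.of_forall fun q =>
        pow_le_pow_left' (enorm_truncate_sub_le n u _ _) 2) hi2.ne
      (Filter.Eventually.of_forall fun q => tendsto_const_nhds.congr' ?_)
    filter_upwards [eventually_truncate_eq u q.2 q.1] with n hn
    simp [hn]
  have hF2' := (memLp_two_iff_lintegral hF2.1).1 hF2
  -- Cauchy–Schwarz, with the $L^2$ bound applied to the nonanticipating difference of `u` and its
  -- truncation.
  have hL : Filter.Tendsto (fun n => ∫ ω, F ω * divergence ν (HawkesIBP.truncate n u) ω ∂P)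
      Filter.atTop (nhds (∫ ω, F ω * divergence ν u ω ∂P)) := by
    refine tendsto_integral_of_L1 _ (hF2.integrable_mul hδ).1
      (Filter.Eventually.of_forall fun n => hF2.integrable_mul (hδn n)) ?_
    have hupper : Filter.Tendsto (fun n => (∫⁻ ω, ‖F ω‖ₑ ^ 2 ∂P) ^ (1 / 2 : ℝ) *
        (∫⁻ q : Config × Mark, ‖HawkesIBP.truncate n u q.2 q.1 - u q.2 q.1‖ₑ ^ 2
          ∂P.prod (intensityMeasure ν)) ^ (1 / 2 : ℝ)) Filter.atTop (nhds 0) := by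
      have h1 := (ENNReal.continuous_rpow_const (y := (1 / 2 : ℝ))).tendsto 0 |>.comp hzero
      rw [ENNReal.zero_rpow_of_pos (by norm_num)] at h1
      have h2 := ENNReal.Tendsto.const_mul (a := (∫⁻ ω, ‖F ω‖ₑ ^ 2 ∂P) ^ (1 / 2 : ℝ)) h1
        (Or.inr (ENNReal.rpow_ne_top_of_nonneg (by norm_num) hF2'.ne))
      rwa [mul_zero] at h2
    refine tendsto_of_tendsto_of_tendsto_of_le_of_le tendsto_const_nhds hupper
      (fun _ => zero_le) fun n => ?_
    have hdi : ∫⁻ ω, ∫⁻ p, ‖HawkesIBP.truncate n u p ω - u p ω‖ₑ ∂intensityMeasure ν ∂P < ∞ :=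
      (lintegral_mono fun ω => lintegral_mono fun p => enorm_truncate_sub_le n u p ω).trans_lt hi
    calc ∫⁻ ω, ‖F ω * divergence ν (HawkesIBP.truncate n u) ω - F ω * divergence ν u ω‖ₑ ∂P
        = ∫⁻ ω, ‖F ω‖ₑ * ‖divergence ν (fun p ω => HawkesIBP.truncate n u p ω - u p ω) ω‖ₑ ∂P := by
          refine lintegral_congr_ae ?_
          filter_upwards [hu.ae_integrable hP hi] with ω hω
          rw [divergence_sub ((boxBounded_truncate n u).integrable (hu.truncate n).measurable
            (toMeasure_box_lt_top ω n) ω) ((boxBounded_truncate n u).integrable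
            (hu.truncate n).measurable (intensityMeasure_box_lt_top ν n) ω) hω.1 hω.2, ← mul_sub,
            enorm_mul]
      _ ≤ (∫⁻ ω, ‖F ω‖ₑ ^ 2 ∂P) ^ (1 / 2 : ℝ) *
          (∫⁻ ω, ‖divergence ν (fun p ω => HawkesIBP.truncate n u p ω - u p ω) ω‖ₑ ^ 2 ∂P) ^
            (1 / 2 : ℝ) :=
          lintegral_mul_le_sqrt_mul_sqrt P hF.enorm.aemeasurable
            (stronglyMeasurable_divergence ν (hdm n)).measurable.enorm.aemeasurable
      _ ≤ _ := mul_le_mul_right (ENNReal.rpow_le_rpow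
          ((hdn n).lintegral_divergence_sq_le hP hdi) (by norm_num)) _
  -- The assumed integrability of $u\,DF$ enters here, as the dominating function.
  have hR : Filter.Tendsto (fun n => ∫ q : Config × Mark, HawkesIBP.truncate n u q.2 q.1 *
      malliavin F q.2 q.1 ∂P.prod (intensityMeasure ν)) Filter.atTop
      (nhds (∫ q : Config × Mark, u q.2 q.1 * malliavin F q.2 q.1 ∂P.prod (intensityMeasure ν))) := by
    refine tendsto_integral_of_dominated_convergence
      (fun q : Config × Mark => ‖u q.2 q.1 * malliavin F q.2 q.1‖)
      (fun n => ((hu.truncate n).measurable.mul (measurable_malliavin hF)).aestronglyMeasurable)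
      hFi.norm (fun n => Filter.Eventually.of_forall fun q => ?_)
      (Filter.Eventually.of_forall fun q => (tendsto_truncate u _ _).mul_const _)
    rw [norm_mul, norm_mul]
    exact mul_le_mul_of_nonneg_right (norm_truncate_le n u _ _) (norm_nonneg _)
  refine tendsto_nhds_unique hL (hR.congr fun n => ?_)
  exact ((boxBounded_truncate n u).integral_mul_divergence hP (hu.truncate n) hF hF2).2.symm

/-- The terms $u_pF\circ\varepsilon_p^+$ and $u_pF$ are integrable separately. By Mecke the first
costs $\mathbb E[|F|\int|u|\,dN]$, and $\int|u|\,dN=\delta^N(|u|)+\int|u|\,dm$ is square integrable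
by the $L^2$ bound and `hi3`; Cauchy–Schwarz concludes. -/
theorem NonAnticipating.integrable_mul_malliavin (hu : NonAnticipating u)
    (hP : IsPoissonLaw P (intensityMeasure ν))
    (hi : ∫⁻ ω, ∫⁻ p, ‖u p ω‖ₑ ∂intensityMeasure ν ∂P < ∞)
    (hi2 : ∫⁻ q : Config × Mark, ‖u q.2 q.1‖ₑ ^ 2 ∂P.prod (intensityMeasure ν) < ∞)
    (hi3 : ∫⁻ ω, (∫⁻ p, ‖u p ω‖ₑ ∂intensityMeasure ν) ^ 2 ∂P < ∞)
    {F : Config → ℝ} (hF : Measurable F) (hF2 : MemLp F 2 P) :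
    Integrable (fun q : Config × Mark => u q.2 q.1 * malliavin F q.2 q.1)
      (P.prod (intensityMeasure ν)) := by
  have hum := hu.measurable
  have hF2' := (memLp_two_iff_lintegral hF2.1).1 hF2
  have han : NonAnticipating fun p ω => ‖u p ω‖ :=
    ⟨hum.norm, fun p q ω h => by rw [hu.apply_shift p q ω h]⟩
  have hT : Measurable fun ω => ∫⁻ p, ‖u p ω‖ₑ ∂intensityMeasure ν :=
    hum.enorm.lintegral_prod_right'
  have hS : Measurable fun ω : Config => ∫⁻ p, ‖u p ω‖ₑ ∂ω.toMeasure :=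
    measurable_lintegral_toMeasure hum.enorm
  have hS2 : ∫⁻ ω, (∫⁻ p, ‖u p ω‖ₑ ∂ω.toMeasure) ^ 2 ∂P < ∞ := by
    have hδ := (han.lintegral_divergence_sq_le hP (by simpa using hi)).trans_lt (by simpa using hi2)
    refine lt_of_le_of_lt (lintegral_mono_ae ?_) (lintegral_add_sq_lt_top
      (stronglyMeasurable_divergence ν hum.norm).measurable.enorm.aemeasurable hδ hi3)
    filter_upwards [hu.ae_integrable hP hi] with ω hω
    refine pow_le_pow_left' ?_ 2
    have h1 : ∀ ρ : Measure Mark, Integrable (fun p => u p ω) ρ →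
        ‖∫ p, ‖u p ω‖ ∂ρ‖ₑ = ∫⁻ p, ‖u p ω‖ₑ ∂ρ := by
      intro ρ hρ
      rw [Real.enorm_of_nonneg (integral_nonneg fun _ => norm_nonneg _),
        ofReal_integral_norm_eq_lintegral_enorm hρ]
    rw [← h1 _ hω.1, ← h1 _ hω.2]
    calc ‖∫ p, ‖u p ω‖ ∂ω.toMeasure‖ₑ
        = ‖divergence ν (fun p ω => ‖u p ω‖) ω + ∫ p, ‖u p ω‖ ∂intensityMeasure ν‖ₑ := by
          rw [divergence, sub_add_cancel]
      _ ≤ _ := enorm_add_le _ _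
  have h1 : ∫⁻ ω, ∫⁻ p, ‖u p ω * F (shift p ω)‖ₑ ∂intensityMeasure ν ∂P < ∞ := by
    have h := hP.lintegral_mecke (u := fun q : Config × Mark => ‖u q.2 q.1 * F q.1‖ₑ)
      (hum.mul (hF.comp measurable_fst)).enorm
    simp only [hu.apply_shift _ _ _ le_rfl] at h
    rw [← h]
    simp only [enorm_mul]
    have h2 : ∀ ω : Config, ∫⁻ p, ‖u p ω‖ₑ * ‖F ω‖ₑ ∂ω.toMeasure =
        (∫⁻ p, ‖u p ω‖ₑ ∂ω.toMeasure) * ‖F ω‖ₑ := fun ω =>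
      lintegral_mul_const' _ _ (by finiteness)
    simp only [h2]
    exact lintegral_mul_lt_top_of_sq hS.aemeasurable hF.enorm.aemeasurable hS2 hF2'
  have h2 : ∫⁻ ω, ∫⁻ p, ‖u p ω * F ω‖ₑ ∂intensityMeasure ν ∂P < ∞ := by
    simp only [enorm_mul]
    have h2 : ∀ ω : Config, ∫⁻ p, ‖u p ω‖ₑ * ‖F ω‖ₑ ∂intensityMeasure ν =
        (∫⁻ p, ‖u p ω‖ₑ ∂intensityMeasure ν) * ‖F ω‖ₑ := fun ω =>
      lintegral_mul_const' _ _ (by finiteness)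
    simp only [h2]
    exact lintegral_mul_lt_top_of_sq hT.aemeasurable hF.enorm.aemeasurable hi3 hF2'
  have hm1 : Measurable fun q : Config × Mark => u q.2 q.1 * F (shift q.2 q.1) :=
    hum.mul (hF.comp measurable_shift)
  have hm2 : Measurable fun q : Config × Mark => u q.2 q.1 * F q.1 :=
    hum.mul (hF.comp measurable_fst)
  have hint1 : Integrable (fun q : Config × Mark => u q.2 q.1 * F (shift q.2 q.1))
      (P.prod (intensityMeasure ν)) := ⟨hm1.aestronglyMeasurable, by
    rwa [HasFiniteIntegral, lintegral_prod _ hm1.enorm.aemeasurable]⟩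
  have hint2 : Integrable (fun q : Config × Mark => u q.2 q.1 * F q.1)
      (P.prod (intensityMeasure ν)) := ⟨hm2.aestronglyMeasurable, by
    rwa [HasFiniteIntegral, lintegral_prod _ hm2.enorm.aemeasurable]⟩
  refine (hint1.sub hint2).congr (Filter.Eventually.of_forall fun q => ?_)
  simp only [Pi.sub_apply, malliavin]
  ring

end Divergence


/-! ### The thinned process -/

section Thinned

variable {ν : Measure ℝ} [IsProbabilityMeasure ν] {P : Measure Config}
  {μ : ℝ≥0} {Φ : ℝ≥0 → ℝ≥0} {hΦ : Measurable Φ} {Z : ℝ≥0 → ℝ → Config → ℝ}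

theorem IsMarkedPredictable.nonAnticipating_thinned
    (hZ : IsMarkedPredictable (filtrationX μ hΦ) Z) : NonAnticipating (thinned μ Φ Z) := by
  refine ⟨Measurable.ite ?_ ?_ measurable_const, fun p q ω h => ?_⟩
  · exact measurableSet_le (f := fun q : Config × Mark => (q.2.2.1 : ℝ≥0∞)) (by fun_prop)
      ((measurable_hawkesIntensity μ hΦ).comp (f := fun q : Config × Mark => (q.1, q.2.1))
        (by fun_prop))
  · exact hZ.measurable.comp (f := fun q : Config × Mark => ((q.2.1, q.1), q.2.2.2)) (by fun_prop)
  · simp only [thinned, hawkesIntensity_shift μ Φ ω h, hZ.apply_shift ω h]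

theorem IsMarkedPredictable.lintegral_thinned (hZ : IsMarkedPredictable (filtrationX μ hΦ) Z)
    (ω : Config) : ∫⁻ p, ‖thinned μ Φ Z p ω‖ₑ ∂intensityMeasure ν =
      ∫⁻ q, ‖Z q.1 q.2 ω‖ₑ * hawkesIntensity μ Φ ω q.1 ∂(lebesgue.prod ν) :=
  lintegral_intensityMeasure_of_eq_ite ν
    (measurable_apply_config hZ.nonAnticipating_thinned.measurable ω).enorm
    (Filter.Eventually.of_forall fun t x θ => by
      simp only [thinned]
      split_ifs <;> simp)

theorem IsMarkedPredictable.lintegral_thinned_sq (hZ : IsMarkedPredictable (filtrationX μ hΦ) Z)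
    (ω : Config) : ∫⁻ p, ‖thinned μ Φ Z p ω‖ₑ ^ 2 ∂intensityMeasure ν =
      ∫⁻ q, ‖Z q.1 q.2 ω‖ₑ ^ 2 * hawkesIntensity μ Φ ω q.1 ∂(lebesgue.prod ν) :=
  lintegral_intensityMeasure_of_eq_ite ν
    ((measurable_apply_config hZ.nonAnticipating_thinned.measurable ω).enorm.pow_const 2)
    (Filter.Eventually.of_forall fun t x θ => by
      simp only [thinned]
      split_ifs <;> simp)

theorem IsMarkedPredictable.memS_thinned [IsProbabilityMeasure P]
    (hZ : IsMarkedPredictable (filtrationX μ hΦ) Z)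
    (hP : IsPoissonLaw P (intensityMeasure ν))
    (hi : ∫⁻ ω, ∫⁻ p, ‖thinned μ Φ Z p ω‖ₑ ∂intensityMeasure ν ∂P < ∞)
    (hi2 : ∫⁻ ω, ∫⁻ p, ‖thinned μ Φ Z p ω‖ₑ ^ 2 ∂intensityMeasure ν ∂P < ∞)
    (hi3 : ∫⁻ ω, ‖∫ q, Z q.1 q.2 ω * (hawkesIntensity μ Φ ω q.1).toReal
      ∂(lebesgue.prod ν)‖ₑ ^ 2 ∂P < ∞) :
    MemS P ν (thinned μ Φ Z) := by
  have hu := hZ.nonAnticipating_thinned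
  have hum := hu.measurable
  have hae := hu.ae_integrable hP hi
  refine ⟨⟨hum, ⟨hum.aestronglyMeasurable, ?_⟩, ?_⟩, hi2, hae.mono fun ω h => h.1, ?_⟩
  · rwa [HasFiniteIntegral, lintegral_prod _ hum.enorm.aemeasurable]
  · refine Filter.Eventually.of_forall fun p => Filter.Eventually.of_forall fun ω => ?_
    rw [malliavin, hu.apply_shift _ _ _ le_rfl, sub_self]
  · have h1 : MemLp (fun ω => ∫ p, thinned μ Φ Z p ω ∂intensityMeasure ν) 2 P := by
      rw [memLp_two_iff_lintegral
        (stronglyMeasurable_integral_intensityMeasure ν hum).aestronglyMeasurable]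
      refine lt_of_le_of_lt (lintegral_mono_ae ?_) hi3
      filter_upwards [hae] with ω hω
      rw [integral_intensityMeasure_of_eq_ite ν (L := hawkesIntensity μ Φ ω) hω.2
        (g := fun q => Z q.1 q.2 ω) (Filter.Eventually.of_forall fun _ _ _ => rfl)]
      simp only [mul_comm, le_refl]
    have h2 := hu.memLp_divergence hP hi
      (by rwa [lintegral_prod _ (hum.enorm.pow_const 2).aemeasurable])
    refine (h2.add h1).ae_eq (Filter.Eventually.of_forall fun ω => ?_)
    simp [divergence]

theorem measurable_malliavinHawkes (μ : ℝ≥0) (hΦ : Measurable Φ) {F : Config → ℝ}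
    (hF : Measurable F) :
    Measurable fun q : Config × (ℝ≥0 × ℝ) => malliavinHawkes μ Φ F q.2.1 q.2.2 q.1 := by
  refine (measurable_malliavin hF).comp (f := fun q : Config × (ℝ≥0 × ℝ) =>
    (q.1, ((q.2.1, (hawkesIntensity μ Φ q.1 q.2.1).toNNReal, q.2.2) : Mark))) ?_
  have h := (measurable_hawkesIntensity μ hΦ).comp
    (f := fun q : Config × (ℝ≥0 × ℝ) => (q.1, q.2.1)) (by fun_prop)
  exact measurable_fst.prodMk ((measurable_fst.comp measurable_snd).prodMk
    (h.ennreal_toNNReal.prodMk (measurable_snd.comp measurable_snd)))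

theorem thinned_mul_malliavin {F : Config → ℝ} {ω : Config}
    (h : ∀ᵐ t ∂lebesgue, ∀ x : ℝ, ∀ θ : ℝ≥0, (θ : ℝ≥0∞) ≤ hawkesIntensity μ Φ ω t →
      malliavin F (t, θ, x) ω = malliavinHawkes μ Φ F t x ω) :
    ∀ᵐ t ∂lebesgue, ∀ (x : ℝ) (θ : ℝ≥0),
      thinned μ Φ Z (t, θ, x) ω * malliavin F (t, θ, x) ω =
        if (θ : ℝ≥0∞) ≤ hawkesIntensity μ Φ ω t then
          Z t x ω * malliavinHawkes μ Φ F t x ω else 0 := by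
  filter_upwards [h] with t ht x θ
  simp only [thinned]
  split_ifs with hθ
  · rw [ht x θ hθ]
  · rw [zero_mul]

/-- For almost every `ω`, integrating the absolute value over `θ` gives the factor $\lambda_t$; as
this is finite, `toReal` loses nothing. -/
theorem IsMarkedPredictable.integrable_thinned_iff [SFinite P]
    (hZ : IsMarkedPredictable (filtrationX μ hΦ) Z)
    {F : Config → ℝ} (hF : Measurable F)
    (hfin : ∀ᵐ ω ∂P, ∀ t, hawkesIntensity μ Φ ω t < ∞)
    (hD : ∀ᵐ ω ∂P, ∀ᵐ t ∂lebesgue, ∀ x : ℝ, ∀ θ : ℝ≥0, (θ : ℝ≥0∞) ≤ hawkesIntensity μ Φ ω t →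
      malliavin F (t, θ, x) ω = malliavinHawkes μ Φ F t x ω) :
    Integrable (fun q : Config × (ℝ≥0 × ℝ) => (hawkesIntensity μ Φ q.1 q.2.1).toReal *
        Z q.2.1 q.2.2 q.1 * malliavinHawkes μ Φ F q.2.1 q.2.2 q.1) (P.prod (lebesgue.prod ν)) ↔
      Integrable (fun q : Config × Mark => thinned μ Φ Z q.2 q.1 * malliavin F q.2 q.1)
        (P.prod (intensityMeasure ν)) := by
  have hm1 : Measurable fun q : Config × (ℝ≥0 × ℝ) => (hawkesIntensity μ Φ q.1 q.2.1).toReal *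
      Z q.2.1 q.2.2 q.1 * malliavinHawkes μ Φ F q.2.1 q.2.2 q.1 := by
    refine Measurable.mul (Measurable.mul ?_ ?_) (measurable_malliavinHawkes μ hΦ hF)
    · exact ((measurable_hawkesIntensity μ hΦ).comp
        (f := fun q : Config × (ℝ≥0 × ℝ) => (q.1, q.2.1)) (by fun_prop)).ennreal_toReal
    · exact hZ.measurable.comp (f := fun q : Config × (ℝ≥0 × ℝ) => ((q.2.1, q.1), q.2.2))
        (by fun_prop)
  have hm2 : Measurable fun q : Config × Mark => thinned μ Φ Z q.2 q.1 * malliavin F q.2 q.1 :=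
    hZ.nonAnticipating_thinned.measurable.mul (measurable_malliavin hF)
  rw [Integrable, Integrable, and_iff_right hm1.aestronglyMeasurable,
    and_iff_right hm2.aestronglyMeasurable, HasFiniteIntegral, HasFiniteIntegral,
    lintegral_prod _ hm1.enorm.aemeasurable, lintegral_prod _ hm2.enorm.aemeasurable]
  refine Eq.to_iff (congrArg (· < ∞) (lintegral_congr_ae ?_))
  filter_upwards [hfin, hD] with ω hω hDω
  rw [lintegral_intensityMeasure_of_eq_ite ν (L := hawkesIntensity μ Φ ω)
    (f := fun p => ‖thinned μ Φ Z p ω * malliavin F p ω‖ₑ)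
    (g := fun q => ‖Z q.1 q.2 ω * malliavinHawkes μ Φ F q.1 q.2 ω‖ₑ)
    (hm2.comp measurable_prodMk_left).enorm]
  · refine lintegral_congr fun q => ?_
    rw [mul_assoc, enorm_mul, mul_comm]
    congr 1
    rw [Real.enorm_of_nonneg ENNReal.toReal_nonneg, ENNReal.ofReal_toReal (hω _).ne]
  · filter_upwards [thinned_mul_malliavin (Z := Z) hDω] with t ht x θ
    rw [ht x θ]
    split_ifs <;> simp

end Thinned

end HawkesIBP

theorem mainTheorem5
    (ν : Measure ℝ) [IsProbabilityMeasure ν] (hν : ν {0} = 0)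
    (P : Measure HawkesIBP.Config) [IsProbabilityMeasure P]
    (hP : HawkesIBP.IsPoissonLaw P (HawkesIBP.intensityMeasure ν))
    (μ : ℝ≥0) (hμ : 0 < μ)
    (Φ : ℝ≥0 → ℝ≥0) (hΦ : Measurable Φ) (hΦ_lt : ∫⁻ u, (Φ u : ℝ≥0∞) ∂HawkesIBP.lebesgue < 1)
    (Z : ℝ≥0 → ℝ → HawkesIBP.Config → ℝ)
    (hZ : HawkesIBP.IsMarkedPredictable (HawkesIBP.filtrationX μ hΦ) Z)
    (hZ_int : ∫⁻ ω, ∫⁻ q, ‖Z q.1 q.2 ω‖ₑ * HawkesIBP.hawkesIntensity μ Φ ω q.1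
      ∂(HawkesIBP.lebesgue.prod ν) ∂P < ∞)
    (hZ_sq : ∫⁻ ω, ((∫⁻ q, ‖Z q.1 q.2 ω‖ₑ ^ 2 * HawkesIBP.hawkesIntensity μ Φ ω q.1
          ∂(HawkesIBP.lebesgue.prod ν)) +
        ‖∫ q, Z q.1 q.2 ω * (HawkesIBP.hawkesIntensity μ Φ ω q.1).toReal
          ∂(HawkesIBP.lebesgue.prod ν)‖ₑ ^ 2) ∂P < ∞) :
    HawkesIBP.MemS P ν (HawkesIBP.thinned μ Φ Z) ∧
    ∀ F : HawkesIBP.Config → ℝ, Measurable[HawkesIBP.sigmaX μ hΦ] F → MemLp F 2 P →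
      (∀ᵐ ω ∂P, ∀ᵐ t ∂HawkesIBP.lebesgue, ∀ x : ℝ, ∀ θ : ℝ≥0,
        (θ : ℝ≥0∞) ≤ HawkesIBP.hawkesIntensity μ Φ ω t →
          HawkesIBP.malliavin F (t, θ, x) ω = HawkesIBP.malliavinHawkes μ Φ F t x ω) ∧
      Integrable (fun ω => F ω * HawkesIBP.divergence ν (HawkesIBP.thinned μ Φ Z) ω) P ∧
      ((∫⁻ ω, (∫⁻ q, ‖Z q.1 q.2 ω‖ₑ * HawkesIBP.hawkesIntensity μ Φ ω q.1
          ∂(HawkesIBP.lebesgue.prod ν)) ^ 2 ∂P < ∞) →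
        Integrable (fun q : HawkesIBP.Config × (ℝ≥0 × ℝ) =>
          (HawkesIBP.hawkesIntensity μ Φ q.1 q.2.1).toReal * Z q.2.1 q.2.2 q.1 *
            HawkesIBP.malliavinHawkes μ Φ F q.2.1 q.2.2 q.1)
          (P.prod (HawkesIBP.lebesgue.prod ν))) ∧
      (Integrable (fun q : HawkesIBP.Config × (ℝ≥0 × ℝ) =>
          (HawkesIBP.hawkesIntensity μ Φ q.1 q.2.1).toReal * Z q.2.1 q.2.2 q.1 *
            HawkesIBP.malliavinHawkes μ Φ F q.2.1 q.2.2 q.1)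
          (P.prod (HawkesIBP.lebesgue.prod ν)) →
        ∫ ω, F ω * HawkesIBP.divergence ν (HawkesIBP.thinned μ Φ Z) ω ∂P =
          ∫ ω, ∫ q, (HawkesIBP.hawkesIntensity μ Φ ω q.1).toReal * Z q.1 q.2 ω *
            HawkesIBP.malliavinHawkes μ Φ F q.1 q.2 ω ∂(HawkesIBP.lebesgue.prod ν) ∂P) := by
  open HawkesIBP in
  have hu := hZ.nonAnticipating_thinned
  have hum := hu.measurable
  have hi : ∫⁻ ω, ∫⁻ p, ‖thinned μ Φ Z p ω‖ₑ ∂intensityMeasure ν ∂P < ∞ := by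
    simpa only [hZ.lintegral_thinned] using hZ_int
  have hi2 : ∫⁻ ω, ∫⁻ p, ‖thinned μ Φ Z p ω‖ₑ ^ 2 ∂intensityMeasure ν ∂P < ∞ := by
    simp only [hZ.lintegral_thinned_sq]
    exact (lintegral_mono fun ω => le_self_add).trans_lt hZ_sq
  have hi2' : ∫⁻ q : Config × Mark, ‖thinned μ Φ Z q.2 q.1‖ₑ ^ 2
      ∂P.prod (intensityMeasure ν) < ∞ := by
    rwa [lintegral_prod _ (hum.enorm.pow_const 2).aemeasurable]
  refine ⟨hZ.memS_thinned hP hi hi2 ((lintegral_mono fun ω => le_add_self).trans_lt hZ_sq),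
    fun F hF hF2 => ?_⟩
  have hFm : Measurable F := hF.mono (iSup_le fun t => (filtrationX μ hΦ).le t) le_rfl
  have hD := hP.ae_malliavin_eq hΦ hΦ_lt hF
  have hfin : ∀ᵐ ω ∂P, ∀ t, hawkesIntensity μ Φ ω t < ∞ :=
    (hP.ae_exists_hawkesIntensity_eq_picard hΦ hΦ_lt).mono fun ω h t => (h t).choose_spec.2
  have hiff := hZ.integrable_thinned_iff (ν := ν) hFm hfin hD
  refine ⟨hD, hF2.integrable_mul (hu.memLp_divergence hP hi hi2'), fun hi3 => ?_, fun hint => ?_⟩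
  · exact hiff.2 (hu.integrable_mul_malliavin hP hi hi2'
      (by simpa only [hZ.lintegral_thinned] using hi3) hFm hF2)
  · have hint' := hiff.1 hint
    -- The formula is applied on the full mark space; `θ` is then integrated out for almost every
    -- `ω`.
    rw [hu.integral_mul_divergence hP hi hi2' hFm hF2 hint', integral_prod _ hint']
    refine integral_congr_ae ?_
    filter_upwards [hD, hint'.prod_right_ae] with ω hω hintω
    rw [integral_intensityMeasure_of_eq_ite ν (L := hawkesIntensity μ Φ ω) hintω
      (g := fun q => Z q.1 q.2 ω * malliavinHawkes μ Φ F q.1 q.2 ω) (thinned_mul_malliavin hω)]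
    simp only [mul_assoc]
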